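/- Let $\Delta$ be a countable alphabet ($\{1,\dots,n\}$ or $\mathbb N$), $\Delta^*$ the set of finite words over $\Delta$, and let $J\subset\mathbb R^d$ be a nonempty compact set with $J=\overline{\operatorname{Int}J}$. Let $(\Omega,\Sigma,P)$ be a probability space and $\{J_\sigma(\omega)\}_{\sigma\in\Delta^*}$ random compact (possibly empty) sets, measurable with respect to the Vietoris topology, that form a random recursive construction: 1. $J_\emptyset=J$ a.s.; a.s. every nonempty $J_\sigma$ is the image of $J$ under a similarity map of $\mathbb R^d$; 2. a.s., for all $\sigma\in\Delta^*$ and $i\in\Delta$, $J_{\sigma*i}$ is a proper subset of $J_\sigma$ if $J_\sigma\neq\emptyset$, and $J_{\sigma*i}=\emptyset$ if $J_\sigma=\emptyset$; 3. for distinct words $\sigma,\tau$ of the same length, $\operatorname{Int}J_\sigma\cap\operatorname{Int}J_\tau=\emptyset$ a.s.; 4. the vectors $\mathbf T_\sigma=(T_{\sigma*i})_{i\in\Delta}$, $T_{\sigma*i}=\operatorname{diam}J_{\sigma*i}/\operatorname{diam}J_\sigma$ (with $0$ if $J_\sigma$ or $J_{\sigma*i}$ is empty), are, given $J_\sigma\ne\emptyset$,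 conditionally i.i.d.: for every finite set $S\subset\Delta^*$ of pairwise prefix-incomparable words, all Borel sets $B_s$ ($s\in S$), and every event $A$ in the $\sigma$-algebra generated by the vectors $\mathbf T_\tau$ with $\tau$ not starting with (or equal to) any word of $S$, $$P\big(A,\ J_s\neq\emptyset\text{ and }\mathbf T_s\in B_s\ \forall s\in S\big)=P\big(A,\ J_s\ne\emptyset\ \forall s\in S\big)\prod_{s\in S}P(\mathbf T_\emptyset\in B_s).$$ Let $K(\omega)=\bigcap_{k\ge1}\bigcup_{|\sigma|=k}J_\sigma(\omega)$ and $l_\sigma=\operatorname{diam}J_\sigma$. Let $N_r(A)$ be the smallest number of closed balls of radius $r$ that cover $A$, $\overline{\dim}_BA=\limsup_{r\to0}\frac{\log N_r(A)}{-\log r}$, $\underline{\dim}_BA=\liminf_{r\to0}\frac{\log N_r(A)}{-\log r}$, and $\dim_PA=\inf\{\sup_i\overline{\dim}_BF_i : A\subset\bigcup_{i\in\mathbb N}F_i\}$; all dimensions of $\emptyset$ are $0$. Let $S^\tau_i$ be (random) similarity maps of $\mathbb R^d$ with $S^\tau_i(J_\tau)=J_{\tau*i}$ whenever $J_{\tau*i}\neq\emptyset$,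 and for $x\in J_\tau$ let $O_\tau(x,1)=\{S^\tau_i(x): i\in\Delta,\ J_{\tau*i}\cap K\neq\emptyset\}$. Assume that the one-step orbits are regular: for every $t>0$ there is a constant $A_t>0$ such that almost surely, for all $\tau\in\Delta^*$ and all $x\in J_\tau$ with $\overline{\dim}_BO_\tau(x,1)<t$, $$N_r\big(O_\tau(x,1)\big)\le A_t\,(l_\tau/r)^{t}\qquad\text{for all }0<r\le 2l_\tau .$$ If the number of offspring $\#\{i\in\Delta: J_i\neq\emptyset\}$ is almost surely finite (not necessarily uniformly bounded), then $$\dim_HK=\dim_PK=\underline{\dim}_BK=\overline{\dim}_BK\qquad\text{a.s.}$$ -/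

import Mathlib

open MeasureTheory TopologicalSpace Filter Topology Set
open scoped NNReal ENNReal

/-! ### Minkowski and packing dimensions

The smallest number `N_r(A)` of closed balls of radius `r` needed to cover `A` is
`Metric.externalCoveringNumber r A`. -/

noncomputable section

/-- The ratio `log N_r(A) / (- log r)`. It is `∞` if `N_r(A) = ∞` and `0` if `A = ∅`
(the ratio is only relevant for `r < 1`). -/
def minkowskiRatio {X : Type*} [PseudoEMetricSpace X] (A : Set X) (r : ℝ≥0) : ℝ≥0∞ :=
  (ENNReal.log (Metric.externalCoveringNumber r A : ℝ≥0∞) /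
    ((-Real.log (r : ℝ) : ℝ) : EReal)).toENNReal

/-- Upper Minkowski dimension. -/
def upperMinkowskiDim {X : Type*} [PseudoEMetricSpace X] (A : Set X) : ℝ≥0∞ :=
  limsup (minkowskiRatio A) (𝓝[>] (0 : ℝ≥0))

/-- Lower Minkowski dimension. -/
def lowerMinkowskiDim {X : Type*} [PseudoEMetricSpace X] (A : Set X) : ℝ≥0∞ :=
  liminf (minkowskiRatio A) (𝓝[>] (0 : ℝ≥0))

/-- Packing dimension: the infimum, over countable covers of `A`, of the supremum of the upper
Minkowski dimensions of the pieces. -/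
def packingDim {X : Type*} [PseudoEMetricSpace X] (A : Set X) : ℝ≥0∞ :=
  ⨅ (F : ℕ → Set X) (_ : A ⊆ ⋃ i, F i), ⨆ i, upperMinkowskiDim (F i)

/-! ### Random recursive constructions -/

/-- A similarity map with ratio `r > 0`. -/
def IsSimilarityMap {X : Type*} [PseudoMetricSpace X] (f : X → X) : Prop :=
  ∃ r : ℝ, 0 < r ∧ ∀ x y, dist (f x) (f y) = r * dist x y

section Construction

variable {ι Ω : Type*} {d : ℕ}

/-- The vector `T_σ = (T_{σ*i})_i` of reduction ratios, `T_{σ*i} = diam J_{σ*i} / diam J_σ`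
(equal to `0` if `J_σ` or `J_{σ*i}` is empty). -/
def reductionVector (J : List ι → Ω → Compacts (EuclideanSpace ℝ (Fin d)))
    (σ : List ι) (ω : Ω) : ι → ℝ :=
  fun i => Metric.diam (J (σ ++ [i]) ω : Set (EuclideanSpace ℝ (Fin d))) /
    Metric.diam (J σ ω : Set (EuclideanSpace ℝ (Fin d)))

/-- The limit set `K(ω) = ⋂_{k ≥ 1} ⋃_{|σ| = k} J_σ(ω)`. -/
def limitSet (J : List ι → Ω → Compacts (EuclideanSpace ℝ (Fin d))) (ω : Ω) :
    Set (EuclideanSpace ℝ (Fin d)) :=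
  ⋂ (k : ℕ) (_ : 1 ≤ k), ⋃ (σ : List ι) (_ : σ.length = k),
    (J σ ω : Set (EuclideanSpace ℝ (Fin d)))

/-- The σ-algebra generated by the vectors `T_τ` over all words `τ` that do not start with
(or equal) a word of `S`. -/
@[reducible] def pastSigmaAlgebra (J : List ι → Ω → Compacts (EuclideanSpace ℝ (Fin d)))
    (S : Finset (List ι)) : MeasurableSpace Ω :=
  ⨆ (τ : List ι) (_ : ∀ s ∈ S, ¬ s <+: τ),
    MeasurableSpace.comap (reductionVector J τ) inferInstance

/-- Given that the cells are nonempty, the reduction vectors are conditionally i.i.d.: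
for every finite antichain `S` of words, every event `A` determined by the reduction vectors at
words outside the subtrees rooted at the words of `S`, and all Borel sets `B_s`,
`P(A, J_s ≠ ∅ and T_s ∈ B_s for all s ∈ S) = P(A, J_s ≠ ∅ for all s ∈ S) ∏_{s ∈ S} P(T_∅ ∈ B_s)`. -/
def CondIID [MeasurableSpace Ω] (P : Measure Ω)
    (J : List ι → Ω → Compacts (EuclideanSpace ℝ (Fin d))) : Prop :=
  ∀ S : Finset (List ι), IsAntichain (fun s t : List ι => s <+: t) (S : Set (List ι)) →
    ∀ A : Set Ω, MeasurableSet[pastSigmaAlgebra J S] A →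
    ∀ B : List ι → Set (ι → ℝ), (∀ s ∈ S, MeasurableSet (B s)) →
      P (A ∩ {ω | ∀ s ∈ S, (J s ω : Set (EuclideanSpace ℝ (Fin d))).Nonempty ∧
          reductionVector J s ω ∈ B s}) =
        P (A ∩ {ω | ∀ s ∈ S, (J s ω : Set (EuclideanSpace ℝ (Fin d))).Nonempty}) *
          ∏ s ∈ S, P {ω | reductionVector J [] ω ∈ B s}

/-- A random recursive construction with seed set `J₀` and cells `J_σ(ω)`, where `σ` runs over
the finite words over the countable alphabet `ι`. -/
structure IsRandomRecursiveConstruction [MeasurableSpace Ω] (P : Measure Ω)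
    (J₀ : Set (EuclideanSpace ℝ (Fin d)))
    (J : List ι → Ω → Compacts (EuclideanSpace ℝ (Fin d))) : Prop where
  seed_nonempty : J₀.Nonempty
  seed_compact : IsCompact J₀
  seed_regular : J₀ = closure (interior J₀)
  root : ∀ᵐ ω ∂P, (J [] ω : Set (EuclideanSpace ℝ (Fin d))) = J₀
  /-- `Compacts` carries the Vietoris topology. -/
  measurable_cell : ∀ σ, @Measurable Ω (Compacts (EuclideanSpace ℝ (Fin d))) _ (borel _) (J σ)
  similar : ∀ᵐ ω ∂P, ∀ σ, (J σ ω : Set (EuclideanSpace ℝ (Fin d))).Nonempty →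
    ∃ f : EuclideanSpace ℝ (Fin d) → EuclideanSpace ℝ (Fin d),
      IsSimilarityMap f ∧ f '' J₀ = (J σ ω : Set (EuclideanSpace ℝ (Fin d)))
  /-- Offspring of a nonempty cell are proper subsets of it. -/
  offspring_ssubset : ∀ᵐ ω ∂P, ∀ σ i, (J σ ω : Set (EuclideanSpace ℝ (Fin d))).Nonempty →
    (J (σ ++ [i]) ω : Set (EuclideanSpace ℝ (Fin d))) ⊂ J σ ω
  /-- An empty cell has no offspring. -/
  offspring_empty : ∀ᵐ ω ∂P, ∀ σ i, (J σ ω : Set (EuclideanSpace ℝ (Fin d))) = ∅ →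
    (J (σ ++ [i]) ω : Set (EuclideanSpace ℝ (Fin d))) = ∅
  open_set_condition : ∀ σ τ : List ι, σ.length = τ.length → σ ≠ τ → ∀ᵐ ω ∂P,
    interior (J σ ω : Set (EuclideanSpace ℝ (Fin d))) ∩ interior (J τ ω) = ∅
  condIID : CondIID P J

/-- `S τ i ω` is, whenever `J_{τ*i}(ω)` is nonempty, a similarity map of the whole space carrying
`J_τ(ω)` onto `J_{τ*i}(ω)`. -/
def IsOffspringSimilarities [MeasurableSpace Ω] (P : Measure Ω)
    (J : List ι → Ω → Compacts (EuclideanSpace ℝ (Fin d)))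
    (S : List ι → ι → Ω → EuclideanSpace ℝ (Fin d) → EuclideanSpace ℝ (Fin d)) : Prop :=
  ∀ᵐ ω ∂P, ∀ τ i, (J (τ ++ [i]) ω : Set (EuclideanSpace ℝ (Fin d))).Nonempty →
    IsSimilarityMap (S τ i ω) ∧
      S τ i ω '' (J τ ω : Set (EuclideanSpace ℝ (Fin d))) = J (τ ++ [i]) ω

/-- The one-step orbit `O_τ(x, 1)` of `x` within `J_τ`: the images of `x` in those offspring of
`J_τ` that meet the limit set. -/
def oneStepOrbit (J : List ι → Ω → Compacts (EuclideanSpace ℝ (Fin d)))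
    (S : List ι → ι → Ω → EuclideanSpace ℝ (Fin d) → EuclideanSpace ℝ (Fin d))
    (τ : List ι) (ω : Ω) (x : EuclideanSpace ℝ (Fin d)) : Set (EuclideanSpace ℝ (Fin d)) :=
  {y | ∃ i, ((J (τ ++ [i]) ω : Set (EuclideanSpace ℝ (Fin d))) ∩ limitSet J ω).Nonempty ∧
    y = S τ i ω x}

/-- Regularity of one-step orbits: for every `t > 0` there is a constant `A > 0` such that almost
surely, for all words `τ` and all `x ∈ J_τ` such that the orbit `O_τ(x, 1)` has upper Minkowski
dimension less than `t`, `N_r(O_τ(x, 1)) ≤ A (l_τ / r) ^ t` for all `0 < r ≤ 2 l_τ`, where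
`l_τ = diam J_τ`. -/
def HasRegularOrbits [MeasurableSpace Ω] (P : Measure Ω)
    (J : List ι → Ω → Compacts (EuclideanSpace ℝ (Fin d)))
    (S : List ι → ι → Ω → EuclideanSpace ℝ (Fin d) → EuclideanSpace ℝ (Fin d)) : Prop :=
  ∀ t : ℝ, 0 < t → ∃ A : ℝ, 0 < A ∧ ∀ᵐ ω ∂P, ∀ τ,
    ∀ x ∈ (J τ ω : Set (EuclideanSpace ℝ (Fin d))),
      upperMinkowskiDim (oneStepOrbit J S τ ω x) < ENNReal.ofReal t →
      ∀ r : ℝ≥0, 0 < r → (r : ℝ) ≤ 2 * Metric.diam (J τ ω : Set (EuclideanSpace ℝ (Fin d))) →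
        (Metric.externalCoveringNumber r (oneStepOrbit J S τ ω x) : ℝ≥0∞) ≤
          ENNReal.ofReal
            (A * (Metric.diam (J τ ω : Set (EuclideanSpace ℝ (Fin d))) / (r : ℝ)) ^ t)

end Construction

end

/-! ### General facts on Minkowski and packing dimensions -/

section Dimensions

/-! Write m(s) = Σ_i E[T_i^s] (`momentSum`). Since dim_H ≤ dim_P ≤ upper Minkowski and dim_H ≤ lower
Minkowski ≤ upper Minkowski hold for every set, it suffices to bound the upper Minkowski dimension
of the limit set by its Hausdorff dimension. Two one-sided estimates do this: the upper Minkowski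
dimension is at most s if m(s) < 1 (`ae_upperMinkowskiDim_le`), and the Hausdorff dimension is at
least s if m(s) > 1 and the limit set is nonempty (`ae_le_dimH`). All ratios are below 1, so m(p) ≤
1 forces m(p') < 1 for p' > p > 0 (`momentSum_lt_one`), which leaves no room for a gap between the
two dimensions. The equation m(s) = 1 need not have a solution.

Upper estimate. By conditional independence, the expectation of Σ_σ l_σ^s is a constant times the
geometric series Σ_k m(s)^k, so the sum is almost surely finite. Each point of the limit set lies in
a first cell of size at most r, hence within r of the one-step orbit of a point chosen in the parent
τ, where l_τ > r. Offspring are finite in number at every cell, so orbits have dimension 0 < s and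
the regularity hypothesis covers each by A (l_τ / r)^s balls of radius r. Summing over τ gives
N_{2r} ≤ A r^{-s} Σ l_τ^s.

Lower estimate. If m(s) > 1, finitely many letters and ratios in [ε, 1 - ε] already give mean above
1. Consider the percolation that keeps offspring i with probability T_i^s, for these letters and
ratios only. No extra randomness is introduced: only its extinction probability given the ratios,
`extinction`, is used, and it satisfies a recursion. Supercriticality provides c < 1 such that at
every alive cell the conditional mean of the extinction probability given the past is at most c. By
Lévy's zero-one law, a surviving tree almost surely has an alive cell ρ with extinction probability
below 1. Every cut Γ below ρ then satisfies Σ_{σ ∈ Γ} l_σ^s ≥ l_ρ^s (1 - extinction), because the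
left side divided by l_ρ^s bounds the mean number of kept cells in the cut. A cover by small balls
induces a cut, with boundedly many cells per ball by volume, so the s-dimensional Hausdorff measure
is positive. -/

lemma neg_log_pos_of_lt_one {r : ℝ≥0} (h0 : 0 < r) (h1 : r < 1) : 0 < -Real.log (r : ℝ) := by
  have := Real.log_neg (x := (r : ℝ)) (by exact_mod_cast h0) (by exact_mod_cast h1)
  linarith

lemma minkowskiRatio_le {X : Type*} [PseudoEMetricSpace X] {A : Set X} {r : ℝ≥0} {C s : ℝ}
    (h0 : 0 < r) (h1 : r < 1) (hC : 0 < C)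
    (h : (Metric.externalCoveringNumber r A : ℝ≥0∞) ≤ ENNReal.ofReal (C * (r : ℝ) ^ (-s))) :
    minkowskiRatio A r ≤ ENNReal.ofReal (s + Real.log C / (-Real.log (r : ℝ))) := by
  have hr : (0 : ℝ) < r := by exact_mod_cast h0
  have hl := neg_log_pos_of_lt_one h0 h1
  have hpos : 0 < C * (r : ℝ) ^ (-s) := by positivity
  have h2 := ENNReal.log_le_log h
  rw [ENNReal.log_ofReal_of_pos hpos] at h2
  have h3 := EReal.div_le_div_right_of_nonneg (c := ((-Real.log (r : ℝ) : ℝ) : EReal))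
    (by exact_mod_cast hl.le) h2
  rw [← EReal.coe_div] at h3
  refine (EReal.toENNReal_le_toENNReal h3).trans ?_
  rw [EReal.real_coe_toENNReal, Real.log_mul hC.ne' (by positivity), Real.log_rpow hr]
  apply le_of_eq
  congr 1
  have : Real.log (r : ℝ) ≠ 0 := by intro h; simp [h] at hl
  field_simp
  ring

lemma externalCoveringNumber_le_of_minkowskiRatio_le {X : Type*} [PseudoEMetricSpace X]
    {A : Set X} {r : ℝ≥0} {s : ℝ} (h0 : 0 < r) (h1 : r < 1) (hs : 0 ≤ s)
    (h : minkowskiRatio A r ≤ ENNReal.ofReal s) :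
    (Metric.externalCoveringNumber r A : ℝ≥0∞) ≤ ENNReal.ofReal ((r : ℝ) ^ (-s)) := by
  have hr : (0 : ℝ) < r := by exact_mod_cast h0
  have hl := neg_log_pos_of_lt_one h0 h1
  have h2 : ENNReal.log (Metric.externalCoveringNumber r A : ℝ≥0∞) /
      ((-Real.log (r : ℝ) : ℝ) : EReal) ≤ (s : EReal) := by
    -- `toENNReal` only truncates negative values, and s ≥ 0, so a ratio exceeding s would still
    -- exceed it after truncation.
    by_contra! hlt
    have := EReal.toENNReal_lt_toENNReal (by exact_mod_cast hs) hlt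
    rw [EReal.real_coe_toENNReal] at this
    exact absurd h (not_le.2 this)
  rw [EReal.div_le_iff_le_mul (by exact_mod_cast hl) (EReal.coe_ne_top _), ← EReal.coe_mul] at h2
  rw [← ENNReal.log_le_log_iff, ENNReal.log_ofReal_of_pos (by positivity), Real.log_rpow hr]
  convert h2 using 2
  ring

lemma tendsto_log_div_neg_log (C : ℝ) :
    Tendsto (fun r : ℝ≥0 => Real.log C / (-Real.log (r : ℝ))) (𝓝[>] 0) (𝓝 0) := by
  apply Tendsto.const_div_atTop
  have h1 : Tendsto (fun r : ℝ≥0 => (r : ℝ)) (𝓝[>] 0) (𝓝[>] 0) := by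
    apply tendsto_nhdsWithin_of_tendsto_nhds_of_eventually_within
    · exact (NNReal.continuous_coe.tendsto' 0 0 rfl).mono_left nhdsWithin_le_nhds
    · filter_upwards [self_mem_nhdsWithin] with r hr
      exact_mod_cast hr
  exact tendsto_neg_atBot_atTop.comp (Real.tendsto_log_nhdsGT_zero.comp h1)

lemma eventually_nhdsGT_zero_lt_one : ∀ᶠ r : ℝ≥0 in 𝓝[>] 0, 0 < r ∧ r < 1 := by
  filter_upwards [self_mem_nhdsWithin, Ioo_mem_nhdsGT (zero_lt_one (α := ℝ≥0))] with r h h'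
  exact ⟨h, h'.2⟩

lemma upperMinkowskiDim_le_of_externalCoveringNumber_le {X : Type*} [PseudoEMetricSpace X]
    {A : Set X} {C s : ℝ} (hC : 0 < C)
    (h : ∀ᶠ r : ℝ≥0 in 𝓝[>] 0,
      (Metric.externalCoveringNumber r A : ℝ≥0∞) ≤ ENNReal.ofReal (C * (r : ℝ) ^ (-s))) :
    upperMinkowskiDim A ≤ ENNReal.ofReal s := by
  have hlim : Tendsto (fun r : ℝ≥0 => ENNReal.ofReal (s + Real.log C / (-Real.log (r : ℝ))))
      (𝓝[>] 0) (𝓝 (ENNReal.ofReal s)) := by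
    apply ENNReal.tendsto_ofReal
    simpa using (tendsto_log_div_neg_log C).const_add s
  rw [← hlim.limsup_eq]
  refine limsup_le_limsup ?_
  filter_upwards [h, eventually_nhdsGT_zero_lt_one] with r hr h01
  exact minkowskiRatio_le h01.1 h01.2 hC hr

lemma upperMinkowskiDim_finite {X : Type*} [PseudoEMetricSpace X] {A : Set X} (hA : A.Finite) :
    upperMinkowskiDim A = 0 := by
  have : upperMinkowskiDim A ≤ ENNReal.ofReal 0 := by
    refine upperMinkowskiDim_le_of_externalCoveringNumber_le (C := A.ncard + 1) (by positivity) ?_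
    refine Eventually.of_forall fun r => ?_
    have h1 := Metric.externalCoveringNumber_le_encard_self (ε := r) A
    rw [← hA.cast_ncard_eq] at h1
    have h2 : (Metric.externalCoveringNumber r A : ℝ≥0∞) ≤ (A.ncard : ℝ≥0∞) := by
      exact_mod_cast h1
    refine h2.trans ?_
    rw [← ENNReal.ofReal_natCast]
    apply ENNReal.ofReal_le_ofReal
    simp
  simpa using this

lemma lowerMinkowskiDim_le_upperMinkowskiDim {X : Type*} [PseudoEMetricSpace X] (A : Set X) :
    lowerMinkowskiDim A ≤ upperMinkowskiDim A :=
  liminf_le_limsup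

lemma packingDim_le_upperMinkowskiDim {X : Type*} [PseudoEMetricSpace X] (A : Set X) :
    packingDim A ≤ upperMinkowskiDim A :=
  iInf₂_le_of_le (fun _ => A) (by simp [iUnion_const]) (by simp)

lemma exists_isCover_encard_eq {X : Type*} [PseudoEMetricSpace X] (r : ℝ≥0) (A : Set X) :
    ∃ C : Set X, Metric.IsCover r A C ∧ C.encard = Metric.externalCoveringNumber r A := by
  have hne : Nonempty {C : Set X // Metric.IsCover r A C} := ⟨⟨A, Metric.IsCover.refl _ _⟩⟩
  obtain ⟨C, hC⟩ := ENat.exists_eq_iInf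
    (fun C : {C : Set X // Metric.IsCover r A C} => C.1.encard)
  exact ⟨C.1, C.2, by rw [hC, Metric.externalCoveringNumber, iInf_subtype]⟩

/-- Along a sequence r_n → 0 there are covers by at most r_n^{-s} balls of diameter at most 2 r_n,
each with s-sum at most 2^s. -/
lemma hausdorffMeasure_le_of_lowerMinkowskiDim_lt {X : Type*} [EMetricSpace X]
    [MeasurableSpace X] [BorelSpace X] {A : Set X} {s : ℝ≥0}
    (h : lowerMinkowskiDim A < s) : μH[s] A ≤ ENNReal.ofReal (2 ^ (s : ℝ)) := by
  have hf := frequently_lt_of_liminf_lt (h := h)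
  have hf' := hf.and_eventually eventually_nhdsGT_zero_lt_one
  obtain ⟨u, hu, hus⟩ := exists_seq_forall_of_frequently hf'
  have hc : ∀ n, ∃ C : Finset X, Metric.IsCover (u n) A C ∧
      (C.card : ℝ≥0∞) ≤ ENNReal.ofReal ((u n : ℝ) ^ (-(s : ℝ))) := by
    intro n
    have h1 := externalCoveringNumber_le_of_minkowskiRatio_le (hus n).2.1 (hus n).2.2
      s.coe_nonneg (by simpa using (hus n).1.le)
    have hlt : Metric.externalCoveringNumber (u n) A < ⊤ := by
      rw [lt_top_iff_ne_top]; intro h; simp [h] at h1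
    obtain ⟨C, hCc, hC'⟩ := exists_isCover_encard_eq (u n) A
    have hfin : C.Finite := by rw [← encard_lt_top_iff, hC']; exact hlt
    refine ⟨hfin.toFinset, by simpa using hCc, ?_⟩
    rw [← hC', hfin.encard_eq_coe_toFinset_card] at h1
    exact_mod_cast h1
  choose C hC hcard using hc
  have hu0 : Tendsto (fun n => 2 * (u n : ℝ≥0∞)) atTop (𝓝 0) := by
    have h1 : Tendsto u atTop (𝓝 0) := hu.mono_right nhdsWithin_le_nhds
    have h2 := ENNReal.Tendsto.const_mul (a := 2) (ENNReal.tendsto_coe.2 h1) (by simp)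
    simpa using h2
  have hd : ∀ n, ∀ i : C n, Metric.ediam (Metric.closedEBall (i : X) (u n)) ≤ 2 * (u n : ℝ≥0∞) :=
    fun n i => Metric.ediam_closedEBall_le
  refine (Measure.hausdorffMeasure_le_liminf_sum (ι := fun n => C n) (s : ℝ) A _ hu0
    (fun n i => Metric.closedEBall (i : X) (u n)) (Eventually.of_forall hd)
    (Eventually.of_forall fun n => ?_)).trans ?_
  · have := Metric.isCover_iff_subset_iUnion_closedEBall.1 (hC n)
    simpa [iUnion_subtype] using this
  · refine (liminf_le_liminf (v := fun _ => ENNReal.ofReal (2 ^ (s : ℝ)))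
      (Eventually.of_forall fun n => ?_)).trans (by simp)
    have hupos : (0 : ℝ) < u n := by exact_mod_cast (hus n).2.1
    calc ∑ i : C n, Metric.ediam (Metric.closedEBall (i : X) (u n)) ^ (s : ℝ)
        ≤ ∑ i : C n, (2 * (u n : ℝ≥0∞)) ^ (s : ℝ) :=
          Finset.sum_le_sum fun i _ => ENNReal.rpow_le_rpow (hd n i) s.2
      _ = (C n).card * (2 * (u n : ℝ≥0∞)) ^ (s : ℝ) := by simp
      _ ≤ ENNReal.ofReal ((u n : ℝ) ^ (-(s : ℝ))) * (2 * (u n : ℝ≥0∞)) ^ (s : ℝ) := by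
          gcongr; exact hcard n
      _ = ENNReal.ofReal (2 ^ (s : ℝ)) := by
          rw [show (2 * (u n : ℝ≥0∞)) = ENNReal.ofReal (2 * (u n : ℝ)) by
            rw [ENNReal.ofReal_mul (by norm_num)]; simp, ENNReal.ofReal_rpow_of_nonneg
            (by positivity) s.coe_nonneg, ← ENNReal.ofReal_mul (by positivity)]
          congr 1
          rw [Real.mul_rpow (by norm_num) hupos.le, Real.rpow_neg hupos.le]
          field_simp

lemma dimH_le_lowerMinkowskiDim {X : Type*} [EMetricSpace X] (A : Set X) :
    dimH A ≤ lowerMinkowskiDim A := by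
  refine ENNReal.le_of_forall_nnreal_lt fun r hr => ?_
  by_contra! hlt
  borelize X
  obtain ⟨t, ht1, ht2⟩ := ENNReal.lt_iff_exists_nnreal_btwn.1 (hlt.trans hr)
  have h1 := hausdorffMeasure_le_of_lowerMinkowskiDim_lt ht1
  exact absurd (dimH_le_of_hausdorffMeasure_ne_top (h1.trans_lt ENNReal.ofReal_lt_top).ne)
    (not_le.2 ht2)

lemma dimH_le_packingDim {X : Type*} [EMetricSpace X] (A : Set X) :
    dimH A ≤ packingDim A := by
  refine le_iInf₂ fun F hF => ?_
  refine (dimH_mono hF).trans ?_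
  rw [dimH_iUnion]
  exact iSup_mono fun i => (dimH_le_lowerMinkowskiDim _).trans
    (lowerMinkowskiDim_le_upperMinkowskiDim _)

lemma dimensions_eq_of_upperMinkowskiDim_le_dimH {X : Type*} [EMetricSpace X] {A : Set X}
    (h : upperMinkowskiDim A ≤ dimH A) :
    dimH A = packingDim A ∧ packingDim A = lowerMinkowskiDim A ∧
      lowerMinkowskiDim A = upperMinkowskiDim A := by
  have h1 := dimH_le_packingDim A
  have h2 := packingDim_le_upperMinkowskiDim A
  have h3 := dimH_le_lowerMinkowskiDim A
  have h4 := lowerMinkowskiDim_le_upperMinkowskiDim A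
  have e1 : dimH A = upperMinkowskiDim A := le_antisymm (h1.trans h2) h
  have e2 : packingDim A = upperMinkowskiDim A := le_antisymm h2 (h.trans h1)
  have e3 : lowerMinkowskiDim A = upperMinkowskiDim A := le_antisymm h4 (h.trans h3)
  exact ⟨e1.trans e2.symm, e2.trans e3.symm, e3⟩

end Dimensions

/-! ### Measurability of the reduction vectors and conditional independence -/

section Independence

/-- A diameter above c is witnessed by two points with open neighbourhoods at mutual distance above
c, and meeting an open set is a Vietoris-open condition. -/
lemma isOpen_setOf_lt_diam {X : Type*} [MetricSpace X] {c : ℝ} (hc : 0 ≤ c) :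
    IsOpen {K : Compacts X | c < Metric.diam (K : Set X)} := by
  have : {K : Compacts X | c < Metric.diam (K : Set X)} =
      ⋃ (p : Set X × Set X) (_ : IsOpen p.1 ∧ IsOpen p.2 ∧ ∀ x ∈ p.1, ∀ y ∈ p.2, c < dist x y),
        {K : Compacts X | ((K : Set X) ∩ p.1).Nonempty} ∩
          {K : Compacts X | ((K : Set X) ∩ p.2).Nonempty} := by
    ext K
    simp only [mem_ofPred_eq, mem_iUnion, mem_inter_iff, exists_prop, Prod.exists]
    constructor
    · intro h
      have : ∃ x ∈ (K : Set X), ∃ y ∈ (K : Set X), c < dist x y := by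
        by_contra! hcon
        exact absurd h (not_lt.2 (Metric.diam_le_of_forall_dist_le hc hcon))
      obtain ⟨x, hx, y, hy, hxy⟩ := this
      refine ⟨Metric.ball x ((dist x y - c) / 2), Metric.ball y ((dist x y - c) / 2),
        ⟨Metric.isOpen_ball, Metric.isOpen_ball, fun x' hx' y' hy' => ?_⟩,
        ⟨x, hx, Metric.mem_ball_self (by linarith)⟩, ⟨y, hy, Metric.mem_ball_self (by linarith)⟩⟩
      rw [Metric.mem_ball] at hx' hy'
      have h1 := dist_triangle4 x x' y' y
      rw [dist_comm x x'] at h1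
      linarith
    · rintro ⟨U, V, ⟨_, _, h⟩, ⟨x, hx, hxU⟩, ⟨y, hy, hyV⟩⟩
      exact (h x hxU y hyV).trans_le (Metric.dist_le_diam_of_mem K.isCompact.isBounded hx hy)
  rw [this]
  refine isOpen_iUnion fun p => isOpen_iUnion fun hp => ?_
  exact (Compacts.isOpen_inter_nonempty_of_isOpen hp.1).inter
    (Compacts.isOpen_inter_nonempty_of_isOpen hp.2.1)

lemma measurable_diam_compacts {X : Type*} [MetricSpace X] :
    @Measurable (Compacts X) ℝ (borel _) _ (fun K => Metric.diam (K : Set X)) := by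
  borelize (Compacts X)
  refine measurable_of_Ioi fun c => ?_
  rcases le_or_gt 0 c with hc | hc
  · exact (isOpen_setOf_lt_diam hc).measurableSet
  · convert MeasurableSet.univ
    ext K
    simpa using hc.trans_le Metric.diam_nonneg

variable {ι Ω : Type*} {d : ℕ} {J : List ι → Ω → Compacts (EuclideanSpace ℝ (Fin d))}

lemma measurable_reductionVector [MeasurableSpace Ω]
    (hJ : ∀ σ, @Measurable Ω (Compacts (EuclideanSpace ℝ (Fin d))) _ (borel _) (J σ))
    (σ : List ι) : Measurable (reductionVector J σ) := by
  refine measurable_pi_lambda _ fun i => ?_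
  exact (measurable_diam_compacts.comp (hJ _)).div (measurable_diam_compacts.comp (hJ _))

lemma pastSigmaAlgebra_le [m0 : MeasurableSpace Ω]
    (hJ : ∀ σ, @Measurable Ω (Compacts (EuclideanSpace ℝ (Fin d))) _ (borel _) (J σ))
    (S : Finset (List ι)) : pastSigmaAlgebra J S ≤ m0 :=
  iSup₂_le fun τ _ => (measurable_reductionVector hJ τ).comap_le

lemma measurable_reductionVector_past {S : Finset (List ι)} {τ : List ι}
    (h : ∀ s ∈ S, ¬ s <+: τ) : Measurable[pastSigmaAlgebra J S] (reductionVector J τ) := by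
  have h1 : MeasurableSpace.comap (reductionVector J τ) inferInstance ≤ pastSigmaAlgebra J S :=
    le_iSup₂_of_le τ h le_rfl
  exact (comap_measurable (reductionVector J τ)).mono h1 le_rfl

lemma pastSigmaAlgebra_append_le (σ : List ι) (i : ι) :
    pastSigmaAlgebra J {σ} ≤ pastSigmaAlgebra J {σ ++ [i]} := by
  refine iSup₂_le fun τ hτ => le_iSup₂_of_le τ ?_ le_rfl
  simp only [Finset.mem_singleton, forall_eq] at hτ ⊢
  exact fun h => hτ ((List.prefix_append _ _).trans h)

/-- The relative diameter of the cell with reversed address. -/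
noncomputable def relDiamRev (J : List ι → Ω → Compacts (EuclideanSpace ℝ (Fin d))) :
    List ι → Ω → ℝ
  | [], _ => 1
  | i :: l, ω => relDiamRev J l ω * reductionVector J l.reverse ω i

/-- The product of the reduction ratios along the prefixes of `σ`. -/
noncomputable def relDiam (J : List ι → Ω → Compacts (EuclideanSpace ℝ (Fin d)))
    (σ : List ι) (ω : Ω) : ℝ := relDiamRev J σ.reverse ω

@[simp] lemma relDiam_nil (ω : Ω) : relDiam J [] ω = 1 := by simp [relDiam, relDiamRev]

lemma relDiam_append (σ : List ι) (i : ι) (ω : Ω) :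
    relDiam J (σ ++ [i]) ω = relDiam J σ ω * reductionVector J σ ω i := by
  simp [relDiam, relDiamRev]

lemma reductionVector_nonneg (σ : List ι) (ω : Ω) (i : ι) : 0 ≤ reductionVector J σ ω i :=
  div_nonneg Metric.diam_nonneg Metric.diam_nonneg

lemma relDiam_nonneg (σ : List ι) (ω : Ω) : 0 ≤ relDiam J σ ω := by
  induction σ using List.reverseRecOn with
  | nil => simp
  | append_singleton l a ih =>
    rw [relDiam_append]
    exact mul_nonneg ih (reductionVector_nonneg _ _ _)

/-- A σ-algebra for which the reduction vectors at all proper prefixes of `σ` are measurable makes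
`relDiam J σ` measurable. -/
lemma measurable_relDiam {m : MeasurableSpace Ω} (σ : List ι)
    (h : ∀ τ, τ <+: σ → τ ≠ σ → Measurable[m] (reductionVector J τ)) :
    Measurable[m] (relDiam J σ) := by
  induction σ using List.reverseRecOn with
  | nil => simp only [show relDiam J ([] : List ι) = fun _ => 1 from funext relDiam_nil]; fun_prop
  | append_singleton l a ih =>
    rw [show relDiam J (l ++ [a]) = fun ω => relDiam J l ω * reductionVector J l ω a from
      funext (relDiam_append l a)]
    refine Measurable.mul (ih fun τ hτ hne => h τ (hτ.trans (List.prefix_append _ _)) ?_)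
      ((measurable_pi_apply a).comp (h l (List.prefix_append _ _) (by simp)))
    rintro rfl
    exact absurd hτ.length_le (by simp)

lemma measurable_relDiam_past (σ : List ι) :
    Measurable[pastSigmaAlgebra J {σ}] (relDiam J σ) := by
  refine measurable_relDiam σ fun τ hτ hne => measurable_reductionVector_past ?_
  simp only [Finset.mem_singleton, forall_eq]
  exact fun h => hne (hτ.eq_of_length_le h.length_le)

/-- The event that the cell at `σ` is alive, in terms of reduction ratios. -/
def aliveSet (J : List ι → Ω → Compacts (EuclideanSpace ℝ (Fin d))) (σ : List ι) : Set Ω :=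
  {ω | 0 < relDiam J σ ω}

lemma measurableSet_aliveSet_past (σ : List ι) :
    MeasurableSet[pastSigmaAlgebra J {σ}] (aliveSet J σ) :=
  measurableSet_lt measurable_const (measurable_relDiam_past σ)

/-! ### Factorization of integrals over alive cells -/

section CondIndep

variable [MeasurableSpace Ω] {P : Measure Ω}
variable (hJm : ∀ σ, @Measurable Ω (Compacts (EuclideanSpace ℝ (Fin d))) _ (borel _) (J σ))
  (hI : CondIID P J)
  (hal : ∀ σ, ∀ᵐ ω ∂P, ω ∈ aliveSet J σ ↔ (J σ ω : Set (EuclideanSpace ℝ (Fin d))).Nonempty)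

include hI hal

/-- `CondIID` for a singleton antichain, with nonemptiness replaced by `aliveSet`, which agrees with
it almost surely and is measurable with respect to the past. -/
lemma measure_inter_preimage_reductionVector (σ : List ι) {A : Set Ω}
    (hA : MeasurableSet[pastSigmaAlgebra J {σ}] A) {B : Set (ι → ℝ)} (hB : MeasurableSet B) :
    P (A ∩ aliveSet J σ ∩ reductionVector J σ ⁻¹' B) =
      P (A ∩ aliveSet J σ) * P (reductionVector J [] ⁻¹' B) := by
  have h := hI {σ} (by simp) A hA (fun _ => B) (fun _ _ => hB)
  simp only [Finset.mem_singleton, forall_eq, Finset.prod_singleton] at h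
  convert h using 1
  · refine measure_congr ?_
    filter_upwards [hal σ] with ω hω
    refine propext ?_
    change ((ω ∈ A ∧ ω ∈ aliveSet J σ) ∧ reductionVector J σ ω ∈ B) ↔ (ω ∈ A ∧ (_ ∧ _))
    rw [hω, and_assoc]
  · congr 1
    refine measure_congr ?_
    filter_upwards [hal σ] with ω hω
    refine propext ?_
    change (ω ∈ A ∧ ω ∈ aliveSet J σ) ↔ (ω ∈ A ∧ (J σ ω : Set (EuclideanSpace ℝ (Fin d))).Nonempty)
    rw [hω]

include hJm

lemma setLIntegral_comp_reductionVector (σ : List ι) {A : Set Ω}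
    (hA : MeasurableSet[pastSigmaAlgebra J {σ}] A) {g : (ι → ℝ) → ℝ≥0∞} (hg : Measurable g) :
    ∫⁻ ω in A ∩ aliveSet J σ, g (reductionVector J σ ω) ∂P =
      P (A ∩ aliveSet J σ) * ∫⁻ ω, g (reductionVector J [] ω) ∂P := by
  have hT := measurable_reductionVector hJm
  have hmap : (P.restrict (A ∩ aliveSet J σ)).map (reductionVector J σ) =
      P (A ∩ aliveSet J σ) • P.map (reductionVector J []) := by
    ext B hB
    rw [Measure.map_apply (hT σ) hB, Measure.restrict_apply (hT σ hB), Measure.smul_apply,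
      Measure.map_apply (hT []) hB, smul_eq_mul, inter_comm,
      measure_inter_preimage_reductionVector hI hal σ hA hB]
  rw [← lintegral_map hg (hT σ), hmap, lintegral_smul_measure, lintegral_map hg (hT []),
    smul_eq_mul]

lemma setLIntegral_mul_comp_reductionVector [IsFiniteMeasure P] (σ : List ι) {b : Ω → ℝ≥0∞}
    (hb : Measurable[pastSigmaAlgebra J {σ}] b) {g : (ι → ℝ) → ℝ≥0∞} (hg : Measurable g) :
    ∫⁻ ω in aliveSet J σ, b ω * g (reductionVector J σ ω) ∂P =
      (∫⁻ ω in aliveSet J σ, b ω ∂P) * ∫⁻ ω, g (reductionVector J [] ω) ∂P := by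
  have hT := measurable_reductionVector hJm
  have hm := pastSigmaAlgebra_le hJm {σ}
  set c := ∫⁻ ω, g (reductionVector J [] ω) ∂P
  set ν := P.restrict (aliveSet J σ)
  -- The density g(T_σ) acts as the constant c on every event of the past, hence on every
  -- past-measurable integrand b.
  have heq : (ν.withDensity fun ω => g (reductionVector J σ ω)).trim hm = (c • ν).trim hm := by
    refine @Measure.ext _ (pastSigmaAlgebra J {σ}) _ _ fun A hA => ?_
    rw [trim_measurableSet_eq hm hA, trim_measurableSet_eq hm hA, withDensity_apply _ (hm A hA),
      Measure.restrict_restrict (hm A hA), Measure.smul_apply,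
      setLIntegral_comp_reductionVector hJm hI hal σ hA hg, Measure.restrict_apply (hm A hA),
      smul_eq_mul, mul_comm]
  calc ∫⁻ ω, b ω * g (reductionVector J σ ω) ∂ν
      = ∫⁻ ω, b ω ∂(ν.withDensity fun ω => g (reductionVector J σ ω)) := by
        rw [lintegral_withDensity_eq_lintegral_mul ν (f := fun ω => g (reductionVector J σ ω))
          (hg.comp (hT σ)) (hb.mono hm le_rfl)]
        simp [mul_comm]
    _ = ∫⁻ ω, b ω ∂(c • ν) := by
        rw [← lintegral_trim hm hb, heq, lintegral_trim hm hb]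
    _ = (∫⁻ ω, b ω ∂ν) * c := by
        rw [lintegral_smul_measure, smul_eq_mul, mul_comm]

end CondIndep

end Independence

/-! ### Percolation on the tree of cells -/

section Percolation

variable {ι Ω : Type*} {d : ℕ}

/-- The conditional probability, given the reduction ratios, that the percolation which keeps the
offspring `i ∈ F` of the cell `σ` with probability `w i (T_σ)` dies out within `n` generations
when started from `σ`. -/
noncomputable def extinction (J : List ι → Ω → Compacts (EuclideanSpace ℝ (Fin d)))
    (F : Finset ι) (w : ι → (ι → ℝ) → ℝ≥0∞) : ℕ → List ι → Ω → ℝ≥0∞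
  | 0, _, _ => 0
  | n + 1, σ, ω => ∏ i ∈ F, (1 - w i (reductionVector J σ ω) +
      w i (reductionVector J σ ω) * extinction J F w n (σ ++ [i]) ω)

variable {J : List ι → Ω → Compacts (EuclideanSpace ℝ (Fin d))}
  {F : Finset ι} {w : ι → (ι → ℝ) → ℝ≥0∞}

lemma measurable_extinction {m : MeasurableSpace Ω} (hw : ∀ i, Measurable (w i)) (n : ℕ) :
    ∀ σ : List ι, (∀ τ, σ <+: τ → Measurable[m] (reductionVector J τ)) →
      Measurable[m] (extinction J F w n σ) := by
  induction n with
  | zero => exact fun σ _ => measurable_const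
  | succ n ih =>
    intro σ h
    have h0 : ∀ i, Measurable[m] fun ω => w i (reductionVector J σ ω) :=
      fun i => (hw i).comp (h σ (List.prefix_refl _))
    have h1 : ∀ i, Measurable[m] (extinction J F w n (σ ++ [i])) :=
      fun i => ih _ fun τ hτ => h τ ((List.prefix_append _ _).trans hτ)
    exact Finset.measurable_prod _ fun i _ =>
      (measurable_const.sub (h0 i)).add ((h0 i).mul (h1 i))

lemma extinction_le_one (hw1 : ∀ i t, w i t ≤ 1) (n : ℕ) (σ : List ι) (ω : Ω) :
    extinction J F w n σ ω ≤ 1 := by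
  induction n generalizing σ with
  | zero => exact zero_le_one
  | succ n ih =>
    refine Finset.prod_le_one' fun i _ => ?_
    calc _ ≤ 1 - w i (reductionVector J σ ω) + w i (reductionVector J σ ω) * 1 := by
          gcongr; exact ih _
      _ = 1 := by rw [mul_one, tsub_add_cancel_of_le (hw1 _ _)]

lemma extinction_le_succ (n : ℕ) (σ : List ι) (ω : Ω) :
    extinction J F w n σ ω ≤ extinction J F w (n + 1) σ ω := by
  induction n generalizing σ with
  | zero => exact zero_le
  | succ n ih =>
    refine Finset.prod_le_prod' fun i _ => ?_
    gcongr
    exact ih _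

lemma aliveSet_append_subset (σ : List ι) (i : ι) : aliveSet J (σ ++ [i]) ⊆ aliveSet J σ := by
  intro ω h
  change 0 < relDiam J (σ ++ [i]) ω at h
  rw [relDiam_append] at h
  exact pos_of_mul_pos_left h (reductionVector_nonneg _ _ _)

lemma mem_aliveSet_append {σ : List ι} {i : ι} {ω : Ω} (h : ω ∈ aliveSet J σ)
    (hi : 0 < reductionVector J σ ω i) : ω ∈ aliveSet J (σ ++ [i]) := by
  change 0 < relDiam J (σ ++ [i]) ω
  rw [relDiam_append]
  exact mul_pos h hi

variable [MeasurableSpace Ω] {P : Measure Ω}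

/-- Passes from a cell to its child, where an induction hypothesis about the child can be applied:
an alive cell with positive i-th ratio has an alive i-th child. -/
lemma setLIntegral_aliveSet_append
    (hJm : ∀ σ, @Measurable Ω (Compacts (EuclideanSpace ℝ (Fin d))) _ (borel _) (J σ))
    (σ : List ι) (i : ι) {f : Ω → ℝ≥0∞}
    (hf : ∀ ω, f ω ≠ 0 → 0 < reductionVector J σ ω i) :
    ∫⁻ ω in aliveSet J σ, f ω ∂P = ∫⁻ ω in aliveSet J (σ ++ [i]), f ω ∂P := by
  have hm : ∀ τ, MeasurableSet (aliveSet J τ) := fun τ =>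
    pastSigmaAlgebra_le hJm {τ} _ (measurableSet_aliveSet_past τ)
  rw [← lintegral_indicator (hm _), ← lintegral_indicator (hm _)]
  congr 1
  ext ω
  by_cases h1 : ω ∈ aliveSet J (σ ++ [i])
  · rw [indicator_of_mem h1, indicator_of_mem (aliveSet_append_subset _ _ h1)]
  · rw [indicator_of_notMem h1]
    by_cases h0 : ω ∈ aliveSet J σ
    · rw [indicator_of_mem h0]
      by_contra hne
      exact h1 (mem_aliveSet_append h0 (hf ω hne))
    · rw [indicator_of_notMem h0]

lemma not_prefix_append_self (σ : List ι) (i : ι) : ¬ σ ++ [i] <+: σ := fun h => by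
  have := h.length_le
  simp at this

lemma not_prefix_of_append_ne {σ τ : List ι} {i j : ι} (hij : i ≠ j) (h : σ ++ [j] <+: τ) :
    ¬ σ ++ [i] <+: τ := by
  intro h'
  have := List.prefix_of_prefix_length_le h' h (by simp)
  have := this.eq_of_length (by simp)
  simp at this
  exact hij this

/-! ### Mean extinction probability given the past -/

section Bounds

variable (hJm : ∀ σ, @Measurable Ω (Compacts (EuclideanSpace ℝ (Fin d))) _ (borel _) (J σ))
  (hI : CondIID P J)
  (hal : ∀ σ, ∀ᵐ ω ∂P, ω ∈ aliveSet J σ ↔ (J σ ω : Set (EuclideanSpace ℝ (Fin d))).Nonempty)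
  (hw : ∀ i, Measurable (w i)) (hw0 : ∀ i t, w i t ≠ 0 → 0 < t i)

include hJm hw hw0 in
-- Offspring are treated one at a time. The factor of offspring `a` depends only on T_σ and the
-- subtree of `a`, which is past for every sibling, so it can be absorbed into `b` while the
-- siblings are replaced by `h`. The bound `ih` at σ ++ [a] then replaces the last factor. In this
-- way bounds for single cells yield the joint bound for all offspring.
lemma setLIntegral_mul_prod_extinction_le {h : ℝ≥0∞} {n : ℕ}
    (ih : ∀ (σ : List ι) (b : Ω → ℝ≥0∞), Measurable[pastSigmaAlgebra J {σ}] b →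
      ∫⁻ ω in aliveSet J σ, b ω * extinction J F w n σ ω ∂P ≤ h * ∫⁻ ω in aliveSet J σ, b ω ∂P)
    (σ : List ι) (G : Finset ι) : ∀ b : Ω → ℝ≥0∞,
      (∀ i ∈ G, Measurable[pastSigmaAlgebra J {σ ++ [i]}] b) →
      ∫⁻ ω in aliveSet J σ, b ω * ∏ i ∈ G, (1 - w i (reductionVector J σ ω) +
          w i (reductionVector J σ ω) * extinction J F w n (σ ++ [i]) ω) ∂P ≤
        ∫⁻ ω in aliveSet J σ, b ω * ∏ i ∈ G, (1 - w i (reductionVector J σ ω) +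
          w i (reductionVector J σ ω) * h) ∂P := by
  classical
  induction G using Finset.induction_on with
  | empty => simp
  | insert a G ha ihG =>
    intro b hb
    have hT : ∀ i, Measurable[pastSigmaAlgebra J {σ ++ [i]}] (reductionVector J σ) := fun i =>
      measurable_reductionVector_past (by simpa using not_prefix_append_self σ i)
    have hwm : ∀ i j, Measurable[pastSigmaAlgebra J {σ ++ [i]}]
        fun ω => w j (reductionVector J σ ω) := fun i j => (hw j).comp (hT i)
    set b' : Ω → ℝ≥0∞ := fun ω => b ω * (1 - w a (reductionVector J σ ω) +
          w a (reductionVector J σ ω) * extinction J F w n (σ ++ [a]) ω) with hb'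
    have hb'm : ∀ i ∈ G, Measurable[pastSigmaAlgebra J {σ ++ [i]}] b' := by
      intro i hi
      have hia : i ≠ a := fun h => ha (h ▸ hi)
      have he : Measurable[pastSigmaAlgebra J {σ ++ [i]}] (extinction J F w n (σ ++ [a])) :=
        measurable_extinction hw n _ fun τ hτ => measurable_reductionVector_past
          (by simpa using not_prefix_of_append_ne hia hτ)
      exact (hb i (Finset.mem_insert_of_mem hi)).mul
        ((measurable_const.sub (hwm i a)).add ((hwm i a).mul he))
    set B : Ω → ℝ≥0∞ := fun ω => b ω * ∏ i ∈ G, (1 - w i (reductionVector J σ ω) +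
          w i (reductionVector J σ ω) * h) with hB
    have hBm : Measurable[pastSigmaAlgebra J {σ ++ [a]}] B :=
      (hb a (Finset.mem_insert_self _ _)).mul (Finset.measurable_prod _ fun i _ =>
        (measurable_const.sub (hwm a i)).add ((hwm a i).mul_const h))
    have hle := pastSigmaAlgebra_le hJm {σ ++ [a]}
    have hBv : Measurable[pastSigmaAlgebra J {σ ++ [a]}]
        fun ω => B ω * (1 - w a (reductionVector J σ ω)) :=
      hBm.mul (measurable_const.sub (hwm a a))
    have hBw : Measurable[pastSigmaAlgebra J {σ ++ [a]}]
        fun ω => B ω * w a (reductionVector J σ ω) := hBm.mul (hwm a a)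
    have hpos : ∀ (X : Ω → ℝ≥0∞) ω, B ω * w a (reductionVector J σ ω) * X ω ≠ 0 →
        0 < reductionVector J σ ω a := fun X ω hne =>
      hw0 a _ (right_ne_zero_of_mul (left_ne_zero_of_mul hne))
    calc ∫⁻ ω in aliveSet J σ, b ω * ∏ i ∈ insert a G, (1 - w i (reductionVector J σ ω) +
          w i (reductionVector J σ ω) * extinction J F w n (σ ++ [i]) ω) ∂P
        = ∫⁻ ω in aliveSet J σ, b' ω * ∏ i ∈ G, (1 - w i (reductionVector J σ ω) +
          w i (reductionVector J σ ω) * extinction J F w n (σ ++ [i]) ω) ∂P := by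
          simp only [hb', Finset.prod_insert ha, mul_assoc]
      _ ≤ ∫⁻ ω in aliveSet J σ, b' ω * ∏ i ∈ G, (1 - w i (reductionVector J σ ω) +
          w i (reductionVector J σ ω) * h) ∂P := ihG b' hb'm
      _ = ∫⁻ ω in aliveSet J σ, (B ω * (1 - w a (reductionVector J σ ω)) +
            B ω * w a (reductionVector J σ ω) * extinction J F w n (σ ++ [a]) ω) ∂P := by
          congr 1; ext ω; simp only [hb', hB]; ring
      _ = ∫⁻ ω in aliveSet J σ, B ω * (1 - w a (reductionVector J σ ω)) ∂P +
            ∫⁻ ω in aliveSet J (σ ++ [a]),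
              B ω * w a (reductionVector J σ ω) * extinction J F w n (σ ++ [a]) ω ∂P := by
          rw [lintegral_add_left (hBv.mono hle le_rfl),
            setLIntegral_aliveSet_append hJm σ a (hpos _)]
      _ ≤ ∫⁻ ω in aliveSet J σ, B ω * (1 - w a (reductionVector J σ ω)) ∂P +
            h * ∫⁻ ω in aliveSet J (σ ++ [a]), B ω * w a (reductionVector J σ ω) ∂P := by
          gcongr
          exact ih (σ ++ [a]) _ hBw
      _ = ∫⁻ ω in aliveSet J σ, B ω * (1 - w a (reductionVector J σ ω)) ∂P +
            ∫⁻ ω in aliveSet J σ, B ω * w a (reductionVector J σ ω) * h ∂P := by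
          rw [setLIntegral_aliveSet_append hJm σ a (hpos fun _ => h),
            lintegral_mul_const _ (hBw.mono hle le_rfl), mul_comm h]
      _ = ∫⁻ ω in aliveSet J σ, b ω * ∏ i ∈ insert a G, (1 - w i (reductionVector J σ ω) +
          w i (reductionVector J σ ω) * h) ∂P := by
          rw [← lintegral_add_left (hBv.mono hle le_rfl)]
          congr 1; ext ω; simp only [hB, Finset.prod_insert ha]; ring

include hJm hI hal hw hw0

/-- Induction on the generation: once the children's extinction probabilities are replaced by `h`,
what remains is a function of T_σ alone. It factors out with the mean of the root, which is at most
`h` by `hh`. -/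
lemma setLIntegral_mul_extinction_le [IsFiniteMeasure P] {h : ℝ≥0∞}
    (hh : ∫⁻ ω, ∏ i ∈ F, (1 - w i (reductionVector J [] ω) +
      w i (reductionVector J [] ω) * h) ∂P ≤ h) (n : ℕ) :
    ∀ (σ : List ι) (b : Ω → ℝ≥0∞), Measurable[pastSigmaAlgebra J {σ}] b →
      ∫⁻ ω in aliveSet J σ, b ω * extinction J F w n σ ω ∂P ≤
        h * ∫⁻ ω in aliveSet J σ, b ω ∂P := by
  induction n with
  | zero => simp [extinction]
  | succ n ih =>
    intro σ b hb
    refine (setLIntegral_mul_prod_extinction_le hJm hw hw0 ih σ F b fun i _ =>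
      hb.mono (pastSigmaAlgebra_append_le σ i) le_rfl).trans ?_
    have hg : Measurable fun t : ι → ℝ => ∏ i ∈ F, (1 - w i t + w i t * h) :=
      Finset.measurable_prod _ fun i _ => (measurable_const.sub (hw i)).add ((hw i).mul_const h)
    rw [setLIntegral_mul_comp_reductionVector hJm hI hal σ hb hg, mul_comm]
    gcongr

lemma measure_inter_aliveSet_extinction_eq_one_le [IsFiniteMeasure P] {h : ℝ≥0∞}
    (hh : ∫⁻ ω, ∏ i ∈ F, (1 - w i (reductionVector J [] ω) +
      w i (reductionVector J [] ω) * h) ∂P ≤ h) (σ : List ι) {A : Set Ω}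
    (hA : MeasurableSet[pastSigmaAlgebra J {σ}] A) :
    P (A ∩ aliveSet J σ ∩ {ω | ⨆ n, extinction J F w n σ ω = 1}) ≤ h * P (A ∩ aliveSet J σ) := by
  have hle := pastSigmaAlgebra_le hJm {σ}
  have hem : ∀ n, Measurable (extinction J F w n σ) := fun n =>
    measurable_extinction hw n σ fun τ _ => measurable_reductionVector hJm τ
  have hAm := hle _ hA
  have hal' : MeasurableSet (aliveSet J σ) := hle _ (measurableSet_aliveSet_past σ)
  have hEm : MeasurableSet {ω | ⨆ n, extinction J F w n σ ω = 1} :=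
    (Measurable.iSup hem) (measurableSet_singleton 1)
  have hb : Measurable[pastSigmaAlgebra J {σ}] (A.indicator fun _ => (1 : ℝ≥0∞)) :=
    measurable_const.indicator hA
  have key : ∫⁻ ω in aliveSet J σ,
      (A.indicator fun _ => (1 : ℝ≥0∞)) ω * ⨆ n, extinction J F w n σ ω ∂P ≤
        h * P (A ∩ aliveSet J σ) := by
    simp_rw [ENNReal.mul_iSup]
    rw [lintegral_iSup (f := fun n ω => (A.indicator fun _ => (1 : ℝ≥0∞)) ω *
      extinction J F w n σ ω) (fun n => (hb.mono hle le_rfl).mul (hem n))]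
    · refine iSup_le fun n => ?_
      refine (setLIntegral_mul_extinction_le hJm hI hal hw hw0 hh n σ _ hb).trans ?_
      rw [lintegral_indicator hAm]
      simp [Measure.restrict_apply hAm]
    · refine monotone_nat_of_le_succ fun n ω => ?_
      dsimp only
      gcongr
      exact extinction_le_succ n σ ω
  refine le_trans ?_ key
  rw [← lintegral_indicator_one ((hAm.inter hal').inter hEm), ← lintegral_indicator hal']
  refine lintegral_mono fun ω => ?_
  by_cases h1 : ω ∈ A ∩ aliveSet J σ ∩ {ω | ⨆ n, extinction J F w n σ ω = 1}
  · rw [indicator_of_mem h1, indicator_of_mem h1.1.2, indicator_of_mem h1.1.1]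
    have : ⨆ n, extinction J F w n σ ω = 1 := h1.2
    rw [this]
    simp
  · rw [indicator_of_notMem h1]
    exact zero_le

end Bounds

end Percolation

/-! ### A zero-one law -/

section ZeroOne

/-- The hypothesis bounds the conditional probabilities of D by h < 1, while by Lévy's upward
theorem they converge almost surely to the indicator of D. -/
lemma measure_eq_zero_of_forall_filtration_inter_le {Ω : Type*} {m0 : MeasurableSpace Ω}
    {P : Measure Ω} [IsFiniteMeasure P] (ℱ : Filtration ℕ m0) {D : Set Ω}
    (hD : MeasurableSet[⨆ n, ℱ n] D) {h : ℝ≥0∞} (h1 : h < 1)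
    (hle : ∀ n A, MeasurableSet[ℱ n] A → P (A ∩ D) ≤ h * P A) : P D = 0 := by
  have hDm : MeasurableSet D := (iSup_le fun n => ℱ.le n) _ hD
  set g : Ω → ℝ := D.indicator fun _ => 1
  have hgi : Integrable g P := (integrable_const _).indicator hDm
  have hgm : StronglyMeasurable[⨆ n, ℱ n] g := stronglyMeasurable_const.indicator hD
  have hlim := hgi.tendsto_ae_condExp hgm
  have hbound : ∀ n, ∀ᵐ ω ∂P, (P[g | ℱ n]) ω ≤ h.toReal := by
    intro n
    have hm := ℱ.le n
    refine ae_le_of_ae_le_trim (hm := hm) (f₂ := fun _ => h.toReal) ?_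
    refine ae_le_of_forall_setIntegral_le (integrable_condExp.trim hm stronglyMeasurable_condExp)
      (integrable_const _) fun A hA _ => ?_
    rw [← setIntegral_trim hm stronglyMeasurable_condExp hA, setIntegral_condExp hm hgi hA,
      setIntegral_const, measureReal_def, trim_measurableSet_eq hm hA,
      setIntegral_indicator hDm, setIntegral_const, smul_eq_mul, mul_one, smul_eq_mul,
      measureReal_def, mul_comm, ← ENNReal.toReal_mul]
    exact ENNReal.toReal_mono (ENNReal.mul_ne_top h1.ne_top (measure_ne_top _ _)) (hle n A hA)
  have hnot : ∀ᵐ ω ∂P, ω ∉ D := by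
    filter_upwards [hlim, ae_all_iff.2 hbound] with ω hω hb hmem
    have h2 : g ω ≤ h.toReal := le_of_tendsto' hω hb
    have h3 : g ω = 1 := indicator_of_mem hmem _
    have h4 : h.toReal < 1 := by
      rw [← ENNReal.toReal_one]; exact ENNReal.toReal_strict_mono ENNReal.one_ne_top h1
    linarith
  simpa [ae_iff] using hnot

variable {ι Ω : Type*} {d : ℕ} {J : List ι → Ω → Compacts (EuclideanSpace ℝ (Fin d))}
  {F : Finset ι} {w : ι → (ι → ℝ) → ℝ≥0∞} [m0 : MeasurableSpace Ω] {P : Measure Ω}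

/-- The filtration generated by the reduction vectors at words of length less than `n`. -/
noncomputable def generationFiltration (J : List ι → Ω → Compacts (EuclideanSpace ℝ (Fin d)))
    (hJm : ∀ σ, @Measurable Ω (Compacts (EuclideanSpace ℝ (Fin d))) _ (borel _) (J σ)) :
    Filtration ℕ m0 where
  seq n := ⨆ (τ : List ι) (_ : τ.length < n),
    MeasurableSpace.comap (reductionVector J τ) inferInstance
  mono' _ _ hnm := iSup₂_le fun τ hτ => le_iSup₂_of_le τ (hτ.trans_le hnm) le_rfl
  le' _ := iSup₂_le fun τ _ => (measurable_reductionVector hJm τ).comap_le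

lemma measurable_generationFiltration
    (hJm : ∀ σ, @Measurable Ω (Compacts (EuclideanSpace ℝ (Fin d))) _ (borel _) (J σ))
    {n : ℕ} {τ : List ι} (h : τ.length < n) :
    Measurable[generationFiltration J hJm n] (reductionVector J τ) := by
  have h1 : MeasurableSpace.comap (reductionVector J τ) inferInstance ≤
    (generationFiltration J hJm n : MeasurableSpace Ω) := le_iSup₂_of_le τ h le_rfl
  exact (comap_measurable (reductionVector J τ)).mono h1 le_rfl

lemma measurable_iSup_generationFiltration
    (hJm : ∀ σ, @Measurable Ω (Compacts (EuclideanSpace ℝ (Fin d))) _ (borel _) (J σ))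
    (τ : List ι) :
    Measurable[⨆ n, generationFiltration J hJm n] (reductionVector J τ) :=
  (measurable_generationFiltration hJm (Nat.lt_succ_self τ.length)).mono
    (le_iSup (fun n => (generationFiltration J hJm n : MeasurableSpace Ω)) _) le_rfl

lemma generationFiltration_le_past
    (hJm : ∀ σ, @Measurable Ω (Compacts (EuclideanSpace ℝ (Fin d))) _ (borel _) (J σ))
    (σ : List ι) : generationFiltration J hJm σ.length ≤ pastSigmaAlgebra J {σ} := by
  refine iSup₂_le fun τ hτ => le_iSup₂_of_le τ ?_ le_rfl
  simp only [Finset.mem_singleton, forall_eq]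
  exact fun h => absurd h.length_le (not_le.2 hτ)

lemma measurableSet_aliveSet_generationFiltration
    (hJm : ∀ σ, @Measurable Ω (Compacts (EuclideanSpace ℝ (Fin d))) _ (borel _) (J σ))
    (σ : List ι) : MeasurableSet[generationFiltration J hJm σ.length] (aliveSet J σ) := by
  refine measurableSet_lt measurable_const (measurable_relDiam σ fun τ hτ hne =>
    measurable_generationFiltration hJm ?_)
  exact lt_of_le_of_ne hτ.length_le fun h => hne (hτ.eq_of_length h)

theorem ae_survive_imp_exists_extinction_ne_one [Countable ι] [IsFiniteMeasure P]
    (hJm : ∀ σ, @Measurable Ω (Compacts (EuclideanSpace ℝ (Fin d))) _ (borel _) (J σ))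
    (hI : CondIID P J)
    (hal : ∀ σ, ∀ᵐ ω ∂P, ω ∈ aliveSet J σ ↔ (J σ ω : Set (EuclideanSpace ℝ (Fin d))).Nonempty)
    (hw : ∀ i, Measurable (w i)) (hw0 : ∀ i t, w i t ≠ 0 → 0 < t i)
    {h : ℝ≥0∞} (h1 : h < 1)
    (hh : ∫⁻ ω, ∏ i ∈ F, (1 - w i (reductionVector J [] ω) +
      w i (reductionVector J [] ω) * h) ∂P ≤ h) :
    ∀ᵐ ω ∂P, (∀ n : ℕ, ∃ σ : List ι, σ.length = n ∧ ω ∈ aliveSet J σ) →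
      ∃ σ : List ι, ω ∈ aliveSet J σ ∧ ⨆ n, extinction J F w n σ ω ≠ 1 := by
  set E : List ι → Set Ω := fun σ => {ω | ⨆ n, extinction J F w n σ ω = 1} with hE
  -- The exceptional event: alive cells exist at every level, yet extinction is certain from each of
  -- them.
  set D : Set Ω := (⋂ n : ℕ, ⋃ (σ : List ι) (_ : σ.length = n), aliveSet J σ) ∩
    ⋂ σ, ((aliveSet J σ)ᶜ ∪ E σ) with hDdef
  have hD : MeasurableSet[⨆ n, generationFiltration J hJm n] D := by
    have hT := measurable_iSup_generationFiltration (J := J) hJm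
    have ha : ∀ σ, MeasurableSet[⨆ n, generationFiltration J hJm n] (aliveSet J σ) := fun σ =>
      measurableSet_lt measurable_const (measurable_relDiam σ fun τ _ _ => hT τ)
    have he : ∀ σ, MeasurableSet[⨆ n, generationFiltration J hJm n] (E σ) := fun σ =>
      (Measurable.iSup fun n => measurable_extinction hw n σ fun τ _ => hT τ)
        (measurableSet_singleton 1)
    refine MeasurableSet.inter ?_ ?_
    · exact MeasurableSet.iInter fun n => MeasurableSet.iUnion fun σ =>
        MeasurableSet.iUnion fun _ => ha σ
    · exact MeasurableSet.iInter fun σ => (ha σ).compl.union (he σ)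
  have hPD : P D = 0 := by
    refine measure_eq_zero_of_forall_filtration_inter_le (generationFiltration J hJm) hD h1 ?_
    intro n A hA
    have hcount : Countable {σ : List ι // σ.length = n} := inferInstance
    have := Encodable.ofCountable {σ : List ι // σ.length = n}
    set L := {σ : List ι // σ.length = n}
    -- The event that σ is the first alive word of length n in a fixed enumeration. These events are
    -- disjoint and known at time n, so the bound for one cell can be summed without a factor
    -- counting the cells.
    set first : L → Set Ω := fun σ => aliveSet J σ.1 \
      ⋃ (τ : L) (_ : Encodable.encode τ < Encodable.encode σ), aliveSet J τ.1 with hfirst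
    have ham : ∀ σ : L, MeasurableSet[generationFiltration J hJm n] (aliveSet J σ.1) := by
      rintro ⟨σ, rfl⟩
      exact measurableSet_aliveSet_generationFiltration hJm σ
    have hfm : ∀ σ : L, MeasurableSet[generationFiltration J hJm n] (first σ) := fun σ =>
      (ham σ).diff (MeasurableSet.iUnion fun τ => MeasurableSet.iUnion fun _ => ham τ)
    have hdisj : Pairwise (Function.onFun Disjoint fun σ => A ∩ first σ) := by
      intro σ τ hne
      refine Set.disjoint_left.2 fun ω hσ hτ => ?_
      rcases lt_trichotomy (Encodable.encode σ) (Encodable.encode τ) with hlt | heq | hlt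
      · exact hτ.2.2 (mem_iUnion₂.2 ⟨σ, hlt, hσ.2.1⟩)
      · exact hne (Encodable.encode_injective heq)
      · exact hσ.2.2 (mem_iUnion₂.2 ⟨τ, hlt, hτ.2.1⟩)
    have hcover : A ∩ D ⊆ ⋃ σ : L, A ∩ first σ ∩ aliveSet J σ.1 ∩ E σ.1 := by
      rintro ω ⟨hωA, hω1, hω2⟩
      obtain ⟨σ₀, hσ₀, hσ₀'⟩ := mem_iUnion₂.1 (mem_iInter.1 hω1 n)
      have hex : ∃ k, ∃ σ : L, Encodable.encode σ = k ∧ ω ∈ aliveSet J σ.1 :=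
        ⟨_, ⟨σ₀, hσ₀⟩, rfl, hσ₀'⟩
      classical
      obtain ⟨σ, hσ, hσa⟩ := Nat.find_spec hex
      refine mem_iUnion.2 ⟨σ, ⟨⟨hωA, hσa, ?_⟩, hσa⟩, ?_⟩
      · intro hmem
        obtain ⟨τ, hτ, hτa⟩ := mem_iUnion₂.1 hmem
        exact Nat.find_min hex (hσ ▸ hτ) ⟨τ, rfl, hτa⟩
      · exact (mem_iInter.1 hω2 σ.1).resolve_left (fun hc => hc hσa)
    have hm := (generationFiltration J hJm).le n
    calc P (A ∩ D) ≤ ∑' σ : L, P (A ∩ first σ ∩ aliveSet J σ.1 ∩ E σ.1) :=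
          (measure_mono hcover).trans (measure_iUnion_le _)
      _ ≤ ∑' σ : L, h * P (A ∩ first σ) := by
          refine ENNReal.tsum_le_tsum fun σ => ?_
          have hpast : MeasurableSet[pastSigmaAlgebra J {σ.1}] (A ∩ first σ) := by
            have := generationFiltration_le_past (J := J) hJm σ.1
            rw [σ.2] at this
            exact this _ (hA.inter (hfm σ))
          refine (measure_inter_aliveSet_extinction_eq_one_le hJm hI hal hw hw0 hh σ.1
            hpast).trans ?_
          exact mul_le_mul' le_rfl (measure_mono inter_subset_left)
      _ = h * P (⋃ σ : L, A ∩ first σ) := by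
          rw [ENNReal.tsum_mul_left, measure_iUnion hdisj fun σ => hm _ (hA.inter (hfm σ))]
      _ ≤ h * P A := by
          gcongr
          exact iUnion_subset fun σ => inter_subset_left
  have hnot : ∀ᵐ ω ∂P, ω ∉ D := by simpa [ae_iff] using hPD
  filter_upwards [hnot] with ω hω hs
  by_contra! hcon
  refine hω ⟨mem_iInter.2 fun n => ?_, mem_iInter.2 fun σ => ?_⟩
  · obtain ⟨σ, hσ, hσ'⟩ := hs n
    exact mem_iUnion₂.2 ⟨σ, hσ, hσ'⟩
  · by_cases ha : ω ∈ aliveSet J σ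
    · exact Or.inr (hcon σ ha)
    · exact Or.inl ha

end ZeroOne

/-! ### Supercritical truncated weights -/

section Supercritical

variable {ι Ω : Type*}

/-- The weight `t_i ^ s`, truncated to ratios `t_i ∈ [ε, 1 - ε]`. -/
noncomputable def truncWeight (s ε : ℝ) (i : ι) (t : ι → ℝ) : ℝ≥0∞ :=
  {u : ℝ | ε ≤ u ∧ u ≤ 1 - ε}.indicator (fun u => ENNReal.ofReal u ^ s) (t i)

lemma truncWeight_of_mem {s ε : ℝ} {i : ι} {t : ι → ℝ} (h : ε ≤ t i ∧ t i ≤ 1 - ε) :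
    truncWeight s ε i t = ENNReal.ofReal (t i) ^ s :=
  indicator_of_mem (s := {u : ℝ | ε ≤ u ∧ u ≤ 1 - ε}) h _

lemma truncWeight_of_notMem {s ε : ℝ} {i : ι} {t : ι → ℝ} (h : ¬ (ε ≤ t i ∧ t i ≤ 1 - ε)) :
    truncWeight s ε i t = 0 :=
  indicator_of_notMem (s := {u : ℝ | ε ≤ u ∧ u ≤ 1 - ε}) h _

lemma mem_of_truncWeight_ne_zero {s ε : ℝ} {i : ι} {t : ι → ℝ} (h : truncWeight s ε i t ≠ 0) :
    ε ≤ t i ∧ t i ≤ 1 - ε := by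
  by_contra hcon
  exact h (truncWeight_of_notMem hcon)

lemma measurable_truncWeight (s ε : ℝ) (i : ι) : Measurable (truncWeight s ε i) := by
  have h : Measurable ({u : ℝ | ε ≤ u ∧ u ≤ 1 - ε}.indicator fun u => ENNReal.ofReal u ^ s) :=
    (ENNReal.measurable_ofReal.pow_const s).indicator measurableSet_Icc
  exact h.comp (measurable_pi_apply i)

lemma truncWeight_le_one {s ε : ℝ} (hs : 0 ≤ s) (hε : 0 ≤ ε) (i : ι) (t : ι → ℝ) :
    truncWeight s ε i t ≤ 1 := by
  by_cases h : ε ≤ t i ∧ t i ≤ 1 - ε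
  · rw [truncWeight_of_mem h]
    exact ENNReal.rpow_le_one (ENNReal.ofReal_le_one.2 (by linarith)) hs
  · rw [truncWeight_of_notMem h]
    exact zero_le_one

lemma truncWeight_anti {s ε ε' : ℝ} (h : ε' ≤ ε) (i : ι) (t : ι → ℝ) :
    truncWeight s ε i t ≤ truncWeight s ε' i t := by
  by_cases hm : ε ≤ t i ∧ t i ≤ 1 - ε
  · rw [truncWeight_of_mem hm, truncWeight_of_mem ⟨by linarith, by linarith⟩]
  · rw [truncWeight_of_notMem hm]
    exact zero_le

/-- The chain is ∏ (1 - x_i) ≤ e^{-y} ≤ 1 / (1 + y) ≤ 1 - y + y², the last step because (1 - y +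
y²)(1 + y) = 1 + y³. -/
lemma prod_one_sub_le {F : Finset ι} {x : ι → ℝ} (hx : ∀ i ∈ F, 0 ≤ x i ∧ x i ≤ 1) :
    ∏ i ∈ F, (1 - x i) ≤ 1 - ∑ i ∈ F, x i + (∑ i ∈ F, x i) ^ 2 := by
  set y := ∑ i ∈ F, x i with hy
  have hy0 : 0 ≤ y := Finset.sum_nonneg fun i hi => (hx i hi).1
  have h1 : ∏ i ∈ F, (1 - x i) ≤ Real.exp (-y) := by
    rw [hy, ← Finset.sum_neg_distrib, Real.exp_sum]
    refine Finset.prod_le_prod (fun i hi => by linarith [(hx i hi).2]) fun i _ => ?_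
    linarith [Real.add_one_le_exp (-x i)]
  refine h1.trans ?_
  have h2 : Real.exp (-y) * (1 + y) ≤ 1 := by
    have : 1 + y ≤ Real.exp y := by linarith [Real.add_one_le_exp y]
    calc Real.exp (-y) * (1 + y) ≤ Real.exp (-y) * Real.exp y := by gcongr
      _ = 1 := by rw [← Real.exp_add]; simp
  have h3 : 1 ≤ (1 - y + y ^ 2) * (1 + y) := by nlinarith [pow_nonneg hy0 3]
  exact le_of_mul_le_mul_right (h2.trans h3) (by linarith)

/-- A second-order upper bound for the offspring generating function at 1 - q, stated additively to
avoid truncated subtraction. -/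
lemma prod_add_mul_sub_add_le {F : Finset ι} {x : ι → ℝ≥0∞} (hx : ∀ i, x i ≤ 1) {q : ℝ}
    (hq0 : 0 ≤ q) (hq1 : q ≤ 1) :
    ∏ i ∈ F, (1 - x i + x i * ENNReal.ofReal (1 - q)) + ENNReal.ofReal q * ∑ i ∈ F, x i ≤
      1 + ENNReal.ofReal (q ^ 2 * (F.card : ℝ) ^ 2) := by
  have hne : ∀ i, x i ≠ ∞ := fun i => ((hx i).trans_lt ENNReal.one_lt_top).ne
  set z : ι → ℝ := fun i => (x i).toReal with hz
  have hz0 : ∀ i, 0 ≤ z i := fun i => ENNReal.toReal_nonneg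
  have hz1 : ∀ i, z i ≤ 1 := fun i => by
    rw [← ENNReal.toReal_one]; exact ENNReal.toReal_mono ENNReal.one_ne_top (hx i)
  have hxz : ∀ i, x i = ENNReal.ofReal (z i) := fun i => (ENNReal.ofReal_toReal (hne i)).symm
  have hfac : ∀ i, 1 - x i + x i * ENNReal.ofReal (1 - q) = ENNReal.ofReal (1 - q * z i) := by
    intro i
    rw [hxz i, ← ENNReal.ofReal_one, ← ENNReal.ofReal_sub _ (hz0 i), ← ENNReal.ofReal_mul (hz0 i),
      ← ENNReal.ofReal_add (by linarith [hz1 i]) (mul_nonneg (hz0 i) (by linarith))]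
    congr 1; ring
  simp_rw [hfac]
  have hqz : ∀ i, 0 ≤ q * z i ∧ q * z i ≤ 1 := fun i =>
    ⟨mul_nonneg hq0 (hz0 i), mul_le_one₀ hq1 (hz0 i) (hz1 i)⟩
  have hS : ∑ i ∈ F, x i = ENNReal.ofReal (∑ i ∈ F, z i) := by
    rw [ENNReal.ofReal_sum_of_nonneg fun i _ => hz0 i]
    exact Finset.sum_congr rfl fun i _ => hxz i
  have hS0 : 0 ≤ ∑ i ∈ F, z i := Finset.sum_nonneg fun i _ => hz0 i
  have hSN : ∑ i ∈ F, z i ≤ F.card := by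
    calc ∑ i ∈ F, z i ≤ ∑ _i ∈ F, (1 : ℝ) := Finset.sum_le_sum fun i _ => hz1 i
      _ = F.card := by rw [Finset.sum_const, nsmul_eq_mul, mul_one]
  rw [hS, ← ENNReal.ofReal_prod_of_nonneg fun i _ => by linarith [(hqz i).2],
    ← ENNReal.ofReal_mul hq0, ← ENNReal.ofReal_add
    (Finset.prod_nonneg fun i _ => by linarith [(hqz i).2]) (by positivity), ← ENNReal.ofReal_one,
    ← ENNReal.ofReal_add (by norm_num) (mul_nonneg (sq_nonneg _) (sq_nonneg _))]
  apply ENNReal.ofReal_le_ofReal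
  have h := prod_one_sub_le (F := F) (x := fun i => q * z i) fun i _ => hqz i
  rw [← Finset.mul_sum] at h
  have h2 : (q * ∑ i ∈ F, z i) ^ 2 ≤ q ^ 2 * (F.card : ℝ) ^ 2 := by
    rw [mul_pow]; gcongr
  linarith

variable [MeasurableSpace Ω] {P : Measure Ω}

/-- The generating function of a supercritical offspring law has slope above 1 at 1, so it lies
below the diagonal just to the left of 1. -/
lemma exists_lintegral_prod_le_of_one_lt [IsProbabilityMeasure P] {F : Finset ι} {x : ι → Ω → ℝ≥0∞}
    (hx : ∀ i ω, x i ω ≤ 1) (hxm : ∀ i, Measurable (x i))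
    (h : 1 < ∫⁻ ω, ∑ i ∈ F, x i ω ∂P) :
    ∃ c : ℝ≥0∞, c < 1 ∧ ∫⁻ ω, ∏ i ∈ F, (1 - x i ω + x i ω * c) ∂P ≤ c := by
  set N : ℝ := (F.card : ℝ)
  have hmN : ∫⁻ ω, ∑ i ∈ F, x i ω ∂P ≤ F.card := by
    calc ∫⁻ ω, ∑ i ∈ F, x i ω ∂P ≤ ∫⁻ _, (F.card : ℝ≥0∞) ∂P := by
          refine lintegral_mono fun ω => ?_
          calc ∑ i ∈ F, x i ω ≤ ∑ _i ∈ F, (1 : ℝ≥0∞) := Finset.sum_le_sum fun i _ => hx i ω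
            _ = F.card := by simp
      _ = F.card := by simp
  set m := ∫⁻ ω, ∑ i ∈ F, x i ω ∂P with hm
  have hmt : m ≠ ∞ := (hmN.trans_lt (ENNReal.natCast_lt_top _)).ne
  set μ := m.toReal
  have hμm : m = ENNReal.ofReal μ := (ENNReal.ofReal_toReal hmt).symm
  have hμ1 : 1 < μ := by
    rw [← ENNReal.toReal_one]; exact ENNReal.toReal_strict_mono hmt h
  have hμN : μ ≤ N := by
    have := ENNReal.toReal_mono (ENNReal.natCast_ne_top F.card) hmN
    simpa using this
  have hN : 1 < N := hμ1.trans_le hμN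
  -- Solves 1 - qμ + q²N² = 1 - q, so the second-order bound gives exactly the value 1 - q.
  set q : ℝ := (μ - 1) / N ^ 2 with hq
  have hq0 : 0 < q := div_pos (by linarith) (pow_pos (by linarith) 2)
  have hq1 : q ≤ 1 := by
    rw [hq, div_le_one (pow_pos (by linarith) 2)]; nlinarith
  have hqN : q * μ = q + q ^ 2 * N ^ 2 := by
    rw [hq]; field_simp; ring
  refine ⟨ENNReal.ofReal (1 - q), by
    rw [← ENNReal.ofReal_one, ENNReal.ofReal_lt_ofReal_iff (by norm_num)]; linarith, ?_⟩
  set I := ∫⁻ ω, ∏ i ∈ F, (1 - x i ω + x i ω * ENNReal.ofReal (1 - q)) ∂P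
  have key : I + ENNReal.ofReal q * m ≤ 1 + ENNReal.ofReal (q ^ 2 * N ^ 2) := by
    have hSm : Measurable fun ω => ∑ i ∈ F, x i ω := Finset.measurable_sum _ fun i _ => hxm i
    rw [hm, ← lintegral_const_mul _ hSm, ← lintegral_add_right _ (hSm.const_mul _)]
    calc _ ≤ ∫⁻ _, (1 + ENNReal.ofReal (q ^ 2 * N ^ 2)) ∂P :=
          lintegral_mono fun ω => prod_add_mul_sub_add_le (fun i => hx i ω) hq0.le hq1
      _ = _ := by simp
  rw [hμm, ← ENNReal.ofReal_mul hq0.le, hqN,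
    ENNReal.ofReal_add hq0.le (mul_nonneg (sq_nonneg _) (sq_nonneg _)),
    ← add_assoc] at key
  have key2 : I + ENNReal.ofReal q ≤ 1 :=
    (ENNReal.add_le_add_iff_right ENNReal.ofReal_ne_top).1 key
  rw [ENNReal.ofReal_sub _ hq0.le, ENNReal.ofReal_one]
  exact ENNReal.le_sub_of_add_le_right ENNReal.ofReal_ne_top key2

/-- A finite partial sum already exceeds 1. Ratios lie in [0, 1) and s > 0 makes zero ratios
contribute nothing, so the truncated weights increase to the full ones as ε decreases to 0. -/
lemma exists_one_lt_lintegral_truncWeight {T : Ω → ι → ℝ} (hT : Measurable T)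
    (hT1 : ∀ᵐ ω ∂P, ∀ i, 0 ≤ T ω i ∧ T ω i < 1) {s : ℝ} (hs : 0 < s)
    (h : 1 < ∑' i, ∫⁻ ω, ENNReal.ofReal (T ω i) ^ s ∂P) :
    ∃ (F : Finset ι) (ε : ℝ), 0 < ε ∧ 1 < ∫⁻ ω, ∑ i ∈ F, truncWeight s ε i (T ω) ∂P := by
  rw [ENNReal.tsum_eq_iSup_sum] at h
  obtain ⟨F, hF⟩ := lt_iSup_iff.1 h
  refine ⟨F, ?_⟩
  have hTi : ∀ i, Measurable fun ω => T ω i := fun i => (measurable_pi_apply i).comp hT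
  have hm : ∀ i, Measurable fun ω => ENNReal.ofReal (T ω i) ^ s := fun i =>
    (hTi i).ennreal_ofReal.pow_const s
  rw [← lintegral_finsetSum _ fun i _ => hm i] at hF
  set e : ℕ → ℝ := fun n => 1 / ((n : ℝ) + 1)
  have he : Antitone e := fun a b hab => by
    simp only [e]; gcongr
  have he0 : Tendsto e atTop (𝓝 0) := tendsto_one_div_add_atTop_nhds_zero_nat
  have hlim : Tendsto (fun n => ∫⁻ ω, ∑ i ∈ F, truncWeight s (e n) i (T ω) ∂P) atTop
      (𝓝 (∫⁻ ω, ∑ i ∈ F, ENNReal.ofReal (T ω i) ^ s ∂P)) := by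
    refine lintegral_tendsto_of_tendsto_of_monotone (fun n => ?_) ?_ ?_
    · exact (Finset.measurable_sum _ fun i _ => (measurable_truncWeight s _ i).comp hT).aemeasurable
    · refine Eventually.of_forall fun ω a b hab => ?_
      exact Finset.sum_le_sum fun i _ => truncWeight_anti (he hab) i _
    · filter_upwards [hT1] with ω hω
      refine tendsto_finsetSum _ fun i _ => ?_
      rcases (hω i).1.eq_or_lt with h0 | h0
      · have hz : ∀ n, truncWeight s (e n) i (T ω) = 0 := fun n =>
          truncWeight_of_notMem fun hc => by
            have : 0 < e n := by positivity
            linarith [hc.1]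
        simp [hz, ← h0, hs]
      · have hpos : 0 < min (T ω i) (1 - T ω i) := lt_min h0 (by linarith [(hω i).2])
        refine tendsto_const_nhds.congr' ?_
        filter_upwards [he0.eventually (gt_mem_nhds hpos)] with n hn
        rw [lt_min_iff] at hn
        exact (truncWeight_of_mem ⟨hn.1.le, by linarith [hn.2]⟩).symm
  obtain ⟨n, hn⟩ := (hlim.eventually (lt_mem_nhds hF)).exists
  exact ⟨e n, by positivity, hn⟩

end Supercritical

/-! ### Similarity maps and volume bounds -/

section Similarity

variable {d : ℕ}

/-- Equality needs surjectivity: r⁻¹ f is an isometry into a strictly convex space, hence affine,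
hence onto by equality of finite dimensions. -/
lemma IsSimilarityMap.image_ball {f : EuclideanSpace ℝ (Fin d) → EuclideanSpace ℝ (Fin d)} {r : ℝ}
    (hr : 0 < r) (hf : ∀ x y, dist (f x) (f y) = r * dist x y) (x : EuclideanSpace ℝ (Fin d))
    (ρ : ℝ) : f '' Metric.ball x ρ = Metric.ball (f x) (r * ρ) := by
  have hiso : Isometry fun y => r⁻¹ • f y := Isometry.of_dist_eq fun y z => by
    rw [dist_smul₀, hf, Real.norm_of_nonneg (by positivity)]
    field_simp
  have hsurj : Function.Surjective fun y => r⁻¹ • f y := by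
    let e := hiso.affineIsometryOfStrictConvexSpace.toAffineIsometryEquiv rfl
    exact e.surjective
  ext y
  constructor
  · rintro ⟨z, hz, rfl⟩
    rw [Metric.mem_ball] at *
    rw [hf]
    gcongr
  · intro hy
    obtain ⟨z, hz⟩ := hsurj (r⁻¹ • y)
    have hz' : f z = y := smul_right_injective _ (inv_ne_zero hr.ne') hz
    refine ⟨z, ?_, hz'⟩
    rw [← hz', Metric.mem_ball, hf] at hy
    exact lt_of_mul_lt_mul_left hy hr.le

lemma diam_image_of_dist_eq {X : Type*} [PseudoMetricSpace X] {f : X → X} {r : ℝ}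
    (hr : 0 < r) (hf : ∀ x y, dist (f x) (f y) = r * dist x y) {A : Set X}
    (hA : Bornology.IsBounded A) : Metric.diam (f '' A) = r * Metric.diam A := by
  apply le_antisymm
  · refine Metric.diam_le_of_forall_dist_le (mul_nonneg hr.le Metric.diam_nonneg) ?_
    rintro _ ⟨x, hx, rfl⟩ _ ⟨y, hy, rfl⟩
    rw [hf]
    exact mul_le_mul_of_nonneg_left (Metric.dist_le_diam_of_mem hA hx hy) hr.le
  · have hb : Bornology.IsBounded (f '' A) := by
      have hl : LipschitzWith (Real.toNNReal r) f := LipschitzWith.of_dist_le_mul fun x y => by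
        rw [hf, Real.coe_toNNReal _ hr.le]
      exact hl.isBounded_image hA
    rw [mul_comm, ← le_div_iff₀ hr]
    refine Metric.diam_le_of_forall_dist_le (div_nonneg Metric.diam_nonneg hr.le) ?_
    intro x hx y hy
    rw [le_div_iff₀ hr, mul_comm, ← hf]
    exact Metric.dist_le_diam_of_mem hb (mem_image_of_mem f hx) (mem_image_of_mem f hy)

lemma encard_le_of_disjoint_balls {α : Type*} [Countable α] {d : ℕ} {Γ : Set α}
    {y : α → EuclideanSpace ℝ (Fin d)} {z : EuclideanSpace ℝ (Fin d)} {a R : ℝ} (ha : 0 < a)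
    (hR : 0 < R) (hdisj : ∀ σ ∈ Γ, ∀ τ ∈ Γ, σ ≠ τ →
      Disjoint (Metric.ball (y σ) a) (Metric.ball (y τ) a))
    (hsub : ∀ σ ∈ Γ, Metric.ball (y σ) a ⊆ Metric.ball z R) :
    (Γ.encard : ℝ≥0∞) ≤ ENNReal.ofReal ((R / a) ^ d) := by
  set v := volume (Metric.ball (0 : EuclideanSpace ℝ (Fin d)) 1)
  have hv0 : v ≠ 0 := (Metric.measure_ball_pos _ _ one_pos).ne'
  have hvt : v ≠ ∞ := measure_ball_lt_top.ne
  have hball : ∀ (x : EuclideanSpace ℝ (Fin d)) {r : ℝ}, 0 < r →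
      volume (Metric.ball x r) = ENNReal.ofReal (r ^ d) * v := fun x r hr => by
    rw [Measure.addHaar_ball_of_pos _ x hr, finrank_euclideanSpace_fin]
  have h1 : ∑' σ : Γ, volume (Metric.ball (y σ) a) ≤ volume (Metric.ball z R) := by
    rw [← measure_iUnion (f := fun σ : Γ => Metric.ball (y σ) a) (fun σ τ hne => hdisj σ σ.2 τ τ.2 fun h => hne (Subtype.ext h))
      fun _ => Metric.isOpen_ball.measurableSet]
    exact measure_mono (iUnion_subset fun σ => hsub σ σ.2)
  rw [tsum_congr fun σ : Γ => hball (y σ) ha, hball _ hR, ENNReal.tsum_set_const, ← mul_assoc] at h1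
  have h2 := (ENNReal.mul_le_mul_iff_left hv0 hvt).1 h1
  rw [div_pow, ENNReal.ofReal_div_of_pos (by positivity), ENNReal.le_div_iff_mul_le
    (Or.inl (by simpa using pow_pos ha d)) (Or.inl ENNReal.ofReal_ne_top)]
  exact h2

end Similarity

/-! ### Trees of cells -/

section CellTree

variable {ι Ω : Type*} {d : ℕ} {J₀ : Set (EuclideanSpace ℝ (Fin d))}

/-- The almost sure geometric properties of the cells of a random recursive construction. -/
structure IsCellTree (J₀ : Set (EuclideanSpace ℝ (Fin d)))
    (C : List ι → Set (EuclideanSpace ℝ (Fin d))) : Prop where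
  compact : ∀ σ, IsCompact (C σ)
  similar : ∀ σ, (C σ).Nonempty → ∃ f, IsSimilarityMap f ∧ f '' J₀ = C σ
  subset : ∀ σ i, C (σ ++ [i]) ⊆ C σ
  disjoint : ∀ σ τ : List ι, σ.length = τ.length → σ ≠ τ → interior (C σ) ∩ interior (C τ) = ∅

variable {C : List ι → Set (EuclideanSpace ℝ (Fin d))}

lemma IsCellTree.subset_of_prefix (hC : IsCellTree J₀ C) {σ τ : List ι} (h : σ <+: τ) :
    C τ ⊆ C σ := by
  obtain ⟨u, rfl⟩ := h
  induction u using List.reverseRecOn with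
  | nil => simp
  | append_singleton l a ih => rw [← List.append_assoc]; exact (hC.subset _ _).trans ih

lemma IsCellTree.diam_le_of_prefix (hC : IsCellTree J₀ C) {σ τ : List ι} (h : σ <+: τ) :
    Metric.diam (C τ) ≤ Metric.diam (C σ) :=
  Metric.diam_mono (hC.subset_of_prefix h) (hC.compact σ).isBounded

lemma IsCellTree.disjoint_interior (hC : IsCellTree J₀ C) {σ τ : List ι} (h1 : ¬ σ <+: τ)
    (h2 : ¬ τ <+: σ) : Disjoint (interior (C σ)) (interior (C τ)) := by
  wlog hle : σ.length ≤ τ.length generalizing σ τ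
  · exact (this h2 h1 (not_le.1 hle).le).symm
  have hne : σ ≠ τ.take σ.length := fun h => h1 (h ▸ List.take_prefix _ _)
  have h := hC.disjoint σ (τ.take σ.length) (by simp [hle]) hne
  exact (disjoint_iff_inter_eq_empty.2 h).mono_right
    (interior_mono (hC.subset_of_prefix (List.take_prefix _ _)))

lemma IsCellTree.exists_ball_subset (hC : IsCellTree J₀ C) {x₀ : EuclideanSpace ℝ (Fin d)}
    {ρ₀ : ℝ} (hb : Metric.ball x₀ ρ₀ ⊆ J₀) (hbd : Bornology.IsBounded J₀)
    (hd : 0 < Metric.diam J₀) {σ : List ι} (hσ : (C σ).Nonempty) :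
    ∃ y, Metric.ball y (ρ₀ / Metric.diam J₀ * Metric.diam (C σ)) ⊆ C σ := by
  obtain ⟨f, ⟨r, hr, hf⟩, hfJ⟩ := hC.similar σ hσ
  refine ⟨f x₀, ?_⟩
  rw [← hfJ, diam_image_of_dist_eq hr hf hbd]
  refine Subset.trans ?_ (image_mono hb)
  rw [IsSimilarityMap.image_ball hr hf]
  apply Metric.ball_subset_ball
  apply le_of_eq
  field_simp

/-- Pairwise incomparable cells of size comparable to `r` that meet a ball of radius `r` are
boundedly many. -/
lemma IsCellTree.encard_le [Countable ι] (hC : IsCellTree J₀ C) {x₀ : EuclideanSpace ℝ (Fin d)}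
    {ρ₀ : ℝ} (hρ : 0 < ρ₀) (hb : Metric.ball x₀ ρ₀ ⊆ J₀) (hbd : Bornology.IsBounded J₀)
    (hd : 0 < Metric.diam J₀) {Γ : Set (List ι)} {z : EuclideanSpace ℝ (Fin d)} {r η : ℝ}
    (hr : 0 < r) (hη : 0 < η) (hanti : ∀ σ ∈ Γ, ∀ τ ∈ Γ, σ <+: τ → σ = τ)
    (hmeet : ∀ σ ∈ Γ, (C σ ∩ Metric.ball z r).Nonempty)
    (hsmall : ∀ σ ∈ Γ, Metric.diam (C σ) ≤ r) (hlarge : ∀ σ ∈ Γ, η * r ≤ Metric.diam (C σ)) :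
    (Γ.encard : ℝ≥0∞) ≤ ENNReal.ofReal ((2 / (ρ₀ / Metric.diam J₀ * η)) ^ d) := by
  have hex : ∀ σ, ∃ y, σ ∈ Γ → Metric.ball y (ρ₀ / Metric.diam J₀ * (η * r)) ⊆ C σ := by
    intro σ
    by_cases hσ : σ ∈ Γ
    · obtain ⟨y, hy⟩ := hC.exists_ball_subset hb hbd hd ((hmeet σ hσ).mono inter_subset_left)
      refine ⟨y, fun _ => (Metric.ball_subset_ball ?_).trans hy⟩
      exact mul_le_mul_of_nonneg_left (hlarge σ hσ) (by positivity)
    · exact ⟨0, fun h => absurd h hσ⟩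
  choose y hy using hex
  -- Each cell contains a ball of radius proportional to its diameter, which is at least ηr, and
  -- lies in the ball of radius 2r about z, since it has diameter at most r and meets the ball of
  -- radius r.
  have h := encard_le_of_disjoint_balls (Γ := Γ) (y := y) (z := z)
    (a := ρ₀ / Metric.diam J₀ * (η * r)) (R := 2 * r) (by positivity) (by positivity) ?_ ?_
  · convert h using 3
    field_simp
  · intro σ hσ τ hτ hne
    exact (hC.disjoint_interior (fun h => hne (hanti σ hσ τ hτ h))
      (fun h => hne (hanti τ hτ σ hσ h).symm)).mono
      (interior_maximal (hy σ hσ) Metric.isOpen_ball)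
      (interior_maximal (hy τ hτ) Metric.isOpen_ball)
  · intro σ hσ x hx
    obtain ⟨u, huC, huz⟩ := hmeet σ hσ
    have h1 := Metric.dist_le_diam_of_mem (hC.compact σ).isBounded (hy σ hσ hx) huC
    rw [Metric.mem_ball] at huz ⊢
    linarith [dist_triangle x u z, hsmall σ hσ]

end CellTree

/-! ### The Hausdorff dimension of surviving trees -/

section Cuts

variable {ι Ω : Type*} {d : ℕ} {J : List ι → Ω → Compacts (EuclideanSpace ℝ (Fin d))}
  {F : Finset ι} {w : ι → (ι → ℝ) → ℝ≥0∞} {ω : Ω} {ρ : List ι}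

/-- `IsOpenDescendant J F w ω ρ n τ` says that `τ` is reached from `ρ` by `n` offspring steps in
`F` of nonzero weight. -/
inductive IsOpenDescendant (J : List ι → Ω → Compacts (EuclideanSpace ℝ (Fin d)))
    (F : Finset ι) (w : ι → (ι → ℝ) → ℝ≥0∞) (ω : Ω) (ρ : List ι) : ℕ → List ι → Prop
  | refl : IsOpenDescendant J F w ω ρ 0 ρ
  | step {n : ℕ} {τ : List ι} {i : ι} (h : IsOpenDescendant J F w ω ρ n τ) (hi : i ∈ F)
      (hw : w i (reductionVector J τ ω) ≠ 0) : IsOpenDescendant J F w ω ρ (n + 1) (τ ++ [i])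

lemma IsOpenDescendant.prefix {n : ℕ} {τ : List ι} (h : IsOpenDescendant J F w ω ρ n τ) :
    ρ <+: τ := by
  induction h with
  | refl => exact List.prefix_refl _
  | step _ _ _ ih => exact ih.trans (List.prefix_append _ _)

lemma IsOpenDescendant.length_eq {n : ℕ} {τ : List ι} (h : IsOpenDescendant J F w ω ρ n τ) :
    τ.length = ρ.length + n := by
  induction h with
  | refl => simp
  | step _ _ _ ih => simp [ih, add_assoc]

lemma IsOpenDescendant.cons {n : ℕ} {τ : List ι} {i : ι} (hi : i ∈ F)
    (hw : w i (reductionVector J ρ ω) ≠ 0) (h : IsOpenDescendant J F w ω (ρ ++ [i]) n τ) :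
    IsOpenDescendant J F w ω ρ (n + 1) τ := by
  induction h with
  | refl => exact .step .refl hi hw
  | step _ hj hwj ih => exact .step ih hj hwj

lemma finite_setOf_isOpenDescendant (n : ℕ) : {τ | IsOpenDescendant J F w ω ρ n τ}.Finite := by
  induction n with
  | zero =>
    refine (finite_singleton ρ).subset ?_
    rintro τ ⟨⟩
    rfl
  | succ n ih =>
    refine ((ih.prod F.finite_toSet).image fun p : List ι × ι => p.1 ++ [p.2]).subset ?_
    rintro _ (_ | ⟨h, hi, _⟩)
    exact ⟨(_, _), ⟨h, hi⟩, rfl⟩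

/-- Along an open path, a property which passes to extensions is acquired at some step. -/
lemma IsOpenDescendant.exists_first {n : ℕ} {τ : List ι} (h : IsOpenDescendant J F w ω ρ n τ)
    {p : List ι → Prop} (h0 : ¬ p ρ) (h1 : p τ) :
    ∃ m σ i, IsOpenDescendant J F w ω ρ m σ ∧ i ∈ F ∧ w i (reductionVector J σ ω) ≠ 0 ∧
      ¬ p σ ∧ p (σ ++ [i]) ∧ σ ++ [i] <+: τ := by
  induction h with
  | refl => exact absurd h1 h0
  | @step m σ i h hi hw ih =>
    by_cases hp : p σ
    · obtain ⟨m', σ', i', h1, h2, h3, h4, h5, h6⟩ := ih hp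
      exact ⟨m', σ', i', h1, h2, h3, h4, h5, h6.trans (List.prefix_append _ _)⟩
    · exact ⟨m, σ, i, h, hi, hw, hp, h1, List.prefix_refl _⟩

/-- The inequalities are composed: the bound for the remaining factors is inserted for `l` in `l * x
a`, and the error terms only shrink when multiplied by x_a ≤ 1. -/
lemma le_mul_prod_add_sum {α : Type*} {G : Finset α} {x y : α → ℝ≥0∞} {l : ℝ≥0∞}
    (hx : ∀ i ∈ G, x i ≤ 1) (h : ∀ i ∈ G, l ≤ l * x i + y i) :
    l ≤ l * ∏ i ∈ G, x i + ∑ i ∈ G, y i := by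
  classical
  induction G using Finset.induction_on with
  | empty => simp
  | insert a G ha ih =>
    have ih' := ih (fun i hi => hx i (Finset.mem_insert_of_mem hi))
      (fun i hi => h i (Finset.mem_insert_of_mem hi))
    have hxa := hx a (Finset.mem_insert_self _ _)
    rw [Finset.prod_insert ha, Finset.sum_insert ha]
    calc l ≤ l * x a + y a := h a (Finset.mem_insert_self _ _)
      _ ≤ (l * ∏ i ∈ G, x i + ∑ i ∈ G, y i) * x a + y a := by gcongr
      _ = l * (x a * ∏ i ∈ G, x i) + (∑ i ∈ G, y i) * x a + y a := by ring
      _ ≤ l * (x a * ∏ i ∈ G, x i) + (∑ i ∈ G, y i) * 1 + y a := by gcongr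
      _ = l * (x a * ∏ i ∈ G, x i) + (y a + ∑ i ∈ G, y i) := by ring

lemma tsum_subtype_add_le_of_disjoint {α κ : Type*} (f : α → ℝ≥0∞) {G : Finset κ}
    {S : κ → Set α} {Γ : Set α} (hsub : ∀ i ∈ G, S i ⊆ Γ)
    (hd : (G : Set κ).PairwiseDisjoint S) : ∑ i ∈ G, ∑' σ : S i, f σ ≤ ∑' σ : Γ, f σ := by
  have h := ENNReal.tsum_biUnion' (f := f) (S := (G : Set κ)) hd
  rw [← Finset.tsum_subtype G fun i => ∑' σ : S i, f σ]
  refine le_trans (le_of_eq h.symm) (ENNReal.tsum_mono_subtype f ?_)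
  exact iUnion₂_subset hsub

/-- A set of words hitting every open path of length `n` from `ρ` carries at least the mass of `ρ`,
up to extinction. -/
lemma le_mul_extinction_add_tsum (hw1 : ∀ i t, w i t ≤ 1) {ℓ : List ι → ℝ≥0∞}
    (hℓ : ∀ σ i, w i (reductionVector J σ ω) ≠ 0 →
      ℓ (σ ++ [i]) = ℓ σ * w i (reductionVector J σ ω)) (n : ℕ) :
    ∀ (ρ : List ι) (Γ : Set (List ι)),
      (∀ τ, IsOpenDescendant J F w ω ρ n τ → ∃ σ ∈ Γ, ρ <+: σ ∧ σ <+: τ) →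
      ℓ ρ ≤ ℓ ρ * extinction J F w n ρ ω + ∑' σ : Γ, ℓ σ := by
  have hroot : ∀ (ρ : List ι) (Γ : Set (List ι)) (c : ℝ≥0∞), ρ ∈ Γ →
      ℓ ρ ≤ c + ∑' σ : Γ, ℓ σ := fun ρ Γ c h =>
    (ENNReal.le_tsum (f := fun σ : Γ => ℓ σ) ⟨ρ, h⟩).trans le_add_self
  induction n with
  | zero =>
    intro ρ Γ h
    obtain ⟨σ, hσ, h1, h2⟩ := h ρ .refl
    exact hroot ρ Γ _ ((h1.eq_of_length_le h2.length_le).symm ▸ hσ)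
  | succ n ih =>
    intro ρ Γ h
    by_cases hρ : ρ ∈ Γ
    · exact hroot ρ Γ _ hρ
    -- As ρ itself is not in the cut, the cut splits into disjoint cuts below the open offspring; a
    -- closed offspring has factor 1 and needs none.
    set S : ι → Set (List ι) := fun i => {σ ∈ Γ | ρ ++ [i] <+: σ}
    have hstep : ∀ i ∈ F, ℓ ρ ≤ ℓ ρ * (1 - w i (reductionVector J ρ ω) +
        w i (reductionVector J ρ ω) * extinction J F w n (ρ ++ [i]) ω) + ∑' σ : S i, ℓ σ := by
      intro i hi
      by_cases hwi : w i (reductionVector J ρ ω) = 0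
      · simp [hwi]
      have hcut := ih (ρ ++ [i]) (S i) fun τ hτ => by
        obtain ⟨σ, hσ, h1, h2⟩ := h τ (hτ.cons hi hwi)
        have hlt : ρ.length < σ.length := lt_of_le_of_ne h1.length_le fun he =>
          hρ (h1.eq_of_length he ▸ hσ)
        have h3 : ρ ++ [i] <+: σ :=
          List.prefix_of_prefix_length_le hτ.prefix h2 (by simpa using hlt)
        exact ⟨σ, ⟨hσ, h3⟩, h3, h2⟩
      rw [hℓ ρ i hwi] at hcut
      calc ℓ ρ = ℓ ρ * (1 - w i (reductionVector J ρ ω)) +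
            ℓ ρ * w i (reductionVector J ρ ω) := by
            rw [← mul_add, tsub_add_cancel_of_le (hw1 _ _), mul_one]
        _ ≤ ℓ ρ * (1 - w i (reductionVector J ρ ω)) + (ℓ ρ * w i (reductionVector J ρ ω) *
            extinction J F w n (ρ ++ [i]) ω + ∑' σ : S i, ℓ σ) := by gcongr
        _ = _ := by ring
    have hle : ∀ i ∈ F, 1 - w i (reductionVector J ρ ω) +
        w i (reductionVector J ρ ω) * extinction J F w n (ρ ++ [i]) ω ≤ 1 := fun i _ => by
      calc _ ≤ 1 - w i (reductionVector J ρ ω) + w i (reductionVector J ρ ω) * 1 := by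
            gcongr; exact extinction_le_one hw1 _ _ _
        _ = 1 := by rw [mul_one, tsub_add_cancel_of_le (hw1 _ _)]
    refine (le_mul_prod_add_sum hle hstep).trans ?_
    refine add_le_add le_rfl (tsum_subtype_add_le_of_disjoint ℓ (fun i _ => sep_subset _ _) ?_)
    intro i _ j _ hij
    exact Set.disjoint_left.2 fun σ hi hj => not_prefix_of_append_ne hij hj.2 hi.2

end Cuts

/-! ### Positive Hausdorff measure below a cell with extinction probability less than one -/

section HausdorffLowerBound

variable {ι Ω : Type*} {d : ℕ}
  {J : List ι → Ω → Compacts (EuclideanSpace ℝ (Fin d))} {J₀ : Set (EuclideanSpace ℝ (Fin d))}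
  {F : Finset ι} {s ε : ℝ} {ω : Ω} {ρ : List ι}

/-- Lets a covering set, possibly empty or a single point, be enlarged to an open ball of positive
radius at arbitrarily small cost. -/
lemma exists_gt_rpow_le_add {s a R : ℝ} (hs : 0 ≤ s) (haR : a < R) {δ : ℝ≥0∞} (hδ : δ ≠ 0) :
    ∃ r, a < r ∧ r < R ∧ ENNReal.ofReal r ^ s ≤ ENNReal.ofReal a ^ s + δ := by
  have hc : Continuous fun r : ℝ => ENNReal.ofReal r ^ s :=
    ENNReal.continuous_rpow_const.comp ENNReal.continuous_ofReal
  have hlt : ENNReal.ofReal a ^ s < ENNReal.ofReal a ^ s + δ :=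
    ENNReal.lt_add_right (ENNReal.rpow_ne_top_of_nonneg hs ENNReal.ofReal_ne_top) hδ
  have h1 : ∀ᶠ r in 𝓝[>] a, ENNReal.ofReal r ^ s < ENNReal.ofReal a ^ s + δ :=
    (hc.tendsto a).mono_left nhdsWithin_le_nhds |>.eventually (gt_mem_nhds hlt)
  obtain ⟨r, h, h'⟩ := (h1.and (Ioo_mem_nhdsGT haR)).exists
  exact ⟨r, h'.1, h'.2, h.le⟩

lemma diam_append_of_truncWeight_ne_zero (hε : 0 < ε) {σ : List ι} {i : ι}
    (h : truncWeight s ε i (reductionVector J σ ω) ≠ 0) :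
    0 < Metric.diam (J σ ω : Set (EuclideanSpace ℝ (Fin d))) ∧
    Metric.diam (J (σ ++ [i]) ω : Set (EuclideanSpace ℝ (Fin d))) =
      Metric.diam (J σ ω : Set (EuclideanSpace ℝ (Fin d))) * reductionVector J σ ω i := by
  have hT := (mem_of_truncWeight_ne_zero h).1
  have hne : Metric.diam (J σ ω : Set (EuclideanSpace ℝ (Fin d))) ≠ 0 := by
    -- With a degenerate parent the ratio would be the default value 0, below ε.
    intro h0
    rw [reductionVector, h0, div_zero] at hT
    linarith
  refine ⟨lt_of_le_of_ne Metric.diam_nonneg hne.symm, ?_⟩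
  rw [reductionVector]
  field_simp

lemma rpow_diam_append_of_truncWeight_ne_zero (hs : 0 ≤ s) (hε : 0 < ε) {σ : List ι} {i : ι}
    (h : truncWeight s ε i (reductionVector J σ ω) ≠ 0) :
    ENNReal.ofReal (Metric.diam (J (σ ++ [i]) ω : Set (EuclideanSpace ℝ (Fin d)))) ^ s =
      ENNReal.ofReal (Metric.diam (J σ ω : Set (EuclideanSpace ℝ (Fin d)))) ^ s *
        truncWeight s ε i (reductionVector J σ ω) := by
  rw [(diam_append_of_truncWeight_ne_zero hε h).2,
    truncWeight_of_mem (mem_of_truncWeight_ne_zero h), ENNReal.ofReal_mul Metric.diam_nonneg,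
    ENNReal.mul_rpow_of_nonneg _ _ hs]

lemma IsOpenDescendant.diam_pos (hε : 0 < ε)
    (hρ : 0 < Metric.diam (J ρ ω : Set (EuclideanSpace ℝ (Fin d)))) {n : ℕ} {τ : List ι}
    (h : IsOpenDescendant J F (truncWeight s ε) ω ρ n τ) :
    0 < Metric.diam (J τ ω : Set (EuclideanSpace ℝ (Fin d))) := by
  induction h with
  | refl => exact hρ
  | step _ _ hw ih =>
    rw [(diam_append_of_truncWeight_ne_zero hε hw).2]
    exact mul_pos ih (hε.trans_le (mem_of_truncWeight_ne_zero hw).1)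

lemma IsOpenDescendant.diam_le (hε : 0 < ε) {n : ℕ} {τ : List ι}
    (h : IsOpenDescendant J F (truncWeight s ε) ω ρ n τ) :
    Metric.diam (J τ ω : Set (EuclideanSpace ℝ (Fin d))) ≤
      (1 - ε) ^ n * Metric.diam (J ρ ω : Set (EuclideanSpace ℝ (Fin d))) := by
  induction h with
  | refl => simp
  | @step n τ i _ _ hw ih =>
    have hm := mem_of_truncWeight_ne_zero hw
    rw [(diam_append_of_truncWeight_ne_zero hε hw).2, pow_succ]
    have h1 : 0 ≤ 1 - ε := by linarith [hm.1, hm.2]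
    calc _ ≤ ((1 - ε) ^ n * Metric.diam (J ρ ω : Set (EuclideanSpace ℝ (Fin d)))) * (1 - ε) := by
          exact mul_le_mul ih hm.2 (hε.le.trans hm.1) (by positivity)
      _ = _ := by ring

lemma nonempty_of_diam_pos {X : Type*} [PseudoMetricSpace X] {A : Set X}
    (h : 0 < Metric.diam A) : A.Nonempty := by
  rw [nonempty_iff_ne_empty]
  rintro rfl
  simp at h

/-- The union of the cells reached by open paths of length `n` from `ρ`. -/
def openLevel (J : List ι → Ω → Compacts (EuclideanSpace ℝ (Fin d))) (F : Finset ι)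
    (w : ι → (ι → ℝ) → ℝ≥0∞) (ω : Ω) (ρ : List ι) (n : ℕ) : Set (EuclideanSpace ℝ (Fin d)) :=
  ⋃ τ ∈ {τ | IsOpenDescendant J F w ω ρ n τ}, (J τ ω : Set (EuclideanSpace ℝ (Fin d)))

lemma isCompact_openLevel {w : ι → (ι → ℝ) → ℝ≥0∞} (n : ℕ) :
    IsCompact (openLevel J F w ω ρ n) :=
  (finite_setOf_isOpenDescendant n).isCompact_biUnion fun τ _ => (J τ ω).isCompact

lemma antitone_openLevel {w : ι → (ι → ℝ) → ℝ≥0∞}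
    (hC : IsCellTree J₀ fun σ => (J σ ω : Set (EuclideanSpace ℝ (Fin d)))) :
    Antitone (openLevel J F w ω ρ) := by
  refine antitone_nat_of_succ_le fun n => iUnion₂_subset ?_
  rintro _ (_ | ⟨h, hi, _⟩)
  exact (hC.subset _ _).trans (subset_biUnion_of_mem (u := fun τ =>
    (J τ ω : Set (EuclideanSpace ℝ (Fin d)))) h)

lemma iInter_openLevel_subset_limitSet {w : ι → (ι → ℝ) → ℝ≥0∞}
    (hC : IsCellTree J₀ fun σ => (J σ ω : Set (EuclideanSpace ℝ (Fin d)))) :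
    ⋂ n, openLevel J F w ω ρ n ⊆ limitSet J ω := by
  intro x hx
  refine mem_iInter₂.2 fun k _ => ?_
  obtain ⟨τ, hτ, hxτ⟩ := mem_iUnion₂.1 (mem_iInter.1 hx k)
  have hlen := IsOpenDescendant.length_eq hτ
  exact mem_iUnion₂.2 ⟨τ.take k, by simp [hlen],
    hC.subset_of_prefix (List.take_prefix _ _) hxτ⟩

/-- The first cells of size at most `r` on open paths from `ρ` that meet the ball of radius `r`
around `z`. -/
def stoppedCells (J : List ι → Ω → Compacts (EuclideanSpace ℝ (Fin d))) (s ε : ℝ)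
    (ω : Ω) (z : EuclideanSpace ℝ (Fin d)) (r : ℝ) : Set (List ι) :=
  {σ | ∃ τ i, σ = τ ++ [i] ∧ truncWeight s ε i (reductionVector J τ ω) ≠ 0 ∧
    r < Metric.diam (J τ ω : Set (EuclideanSpace ℝ (Fin d))) ∧
    Metric.diam (J σ ω : Set (EuclideanSpace ℝ (Fin d))) ≤ r ∧
    ((J σ ω : Set (EuclideanSpace ℝ (Fin d))) ∩ Metric.ball z r).Nonempty}

/-- A stopped cell has a parent larger than r and a ratio at least ε, so its size lies between εr
and r and the volume bound applies. -/
lemma tsum_stoppedCells_le [Countable ι]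
    (hC : IsCellTree J₀ fun σ => (J σ ω : Set (EuclideanSpace ℝ (Fin d))))
    {x₀ : EuclideanSpace ℝ (Fin d)} {ρ₀ : ℝ} (hρ : 0 < ρ₀) (hb : Metric.ball x₀ ρ₀ ⊆ J₀)
    (hbd : Bornology.IsBounded J₀) (hd : 0 < Metric.diam J₀) (hs : 0 ≤ s) (hε : 0 < ε)
    (z : EuclideanSpace ℝ (Fin d)) {r : ℝ} (hr : 0 < r) :
    ∑' σ : stoppedCells J s ε ω z r,
      ENNReal.ofReal (Metric.diam (J σ ω : Set (EuclideanSpace ℝ (Fin d)))) ^ s ≤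
      ENNReal.ofReal ((2 / (ρ₀ / Metric.diam J₀ * ε)) ^ d) * ENNReal.ofReal r ^ s := by
  have hcard := hC.encard_le hρ hb hbd hd (Γ := stoppedCells J s ε ω z r) (z := z) hr hε
    (by
      rintro σ hσ _ ⟨τ', i', rfl, -, hlt', -, -⟩ hpre
      rcases List.prefix_concat_iff.1 hpre with h | h
      · exact h
      -- A stopped word that is a prefix of the other word's parent would make that parent no larger
      -- than r.
      · obtain ⟨τ, i, rfl, -, -, hle, -⟩ := hσ
        exact absurd (hC.diam_le_of_prefix h) (not_le.2 (hle.trans_lt hlt')))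
    (by rintro σ ⟨τ, i, -, -, -, -, h⟩; exact h)
    (by rintro σ ⟨τ, i, -, -, -, h, -⟩; exact h)
    (by
      rintro _ ⟨τ, i, rfl, hw, hlt, -, -⟩
      rw [(diam_append_of_truncWeight_ne_zero hε hw).2, mul_comm]
      exact mul_le_mul hlt.le (mem_of_truncWeight_ne_zero hw).1 hε.le Metric.diam_nonneg)
  calc _ ≤ ∑' _σ : stoppedCells J s ε ω z r, ENNReal.ofReal r ^ s := by
        refine ENNReal.tsum_le_tsum ?_
        rintro ⟨σ, τ, i, -, -, -, h, -⟩
        gcongr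
    _ ≤ _ := by
        rw [ENNReal.tsum_set_const]
        gcongr

/-- A mass distribution argument without constructing a measure: the cut inequality bounds the cost
of every fine cover of the open part of the limit set from below. -/
theorem le_dimH_limitSet_of_extinction_ne_one [Countable ι]
    (hC : IsCellTree J₀ fun σ => (J σ ω : Set (EuclideanSpace ℝ (Fin d))))
    {x₀ : EuclideanSpace ℝ (Fin d)} {ρ₀ : ℝ} (hρ₀ : 0 < ρ₀) (hb : Metric.ball x₀ ρ₀ ⊆ J₀)
    (hbd : Bornology.IsBounded J₀) (hd : 0 < Metric.diam J₀) (hs : 0 < s) (hε : 0 < ε)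
    (hρ : 0 < Metric.diam (J ρ ω : Set (EuclideanSpace ℝ (Fin d))))
    (hext : ⨆ n, extinction J F (truncWeight s ε) n ρ ω ≠ 1) :
    ENNReal.ofReal s ≤ dimH (limitSet J ω) := by
  set l := fun σ => Metric.diam (J σ ω : Set (EuclideanSpace ℝ (Fin d))) with hl
  set ℓ : List ι → ℝ≥0∞ := fun σ => ENNReal.ofReal (l σ) ^ s with hℓ
  set w : ι → (ι → ℝ) → ℝ≥0∞ := truncWeight s ε with hw
  have hw1 : ∀ i t, w i t ≤ 1 := truncWeight_le_one hs.le hε.le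
  set M := ENNReal.ofReal ((2 / (ρ₀ / Metric.diam J₀ * ε)) ^ d) with hM
  have hMt : M ≠ ∞ := ENNReal.ofReal_ne_top
  set Ψ := ⨆ n, extinction J F w n ρ ω with hΨ
  have hΨ1 : Ψ < 1 := lt_of_le_of_ne (iSup_le fun n => extinction_le_one hw1 _ _ _) hext
  have hℓρt : ℓ ρ ≠ ∞ := ENNReal.rpow_ne_top_of_nonneg hs.le ENNReal.ofReal_ne_top
  have hℓρ0 : ℓ ρ ≠ 0 := by
    simp only [hℓ, ne_eq, ENNReal.rpow_eq_zero_iff, ENNReal.ofReal_eq_zero,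
      ENNReal.ofReal_ne_top, false_and, or_false, not_and, not_lt]
    exact fun h => absurd hρ (not_lt.2 h)
  set K := ⋂ n, openLevel J F w ω ρ n
  have hcut : ∀ (n : ℕ) (Γ : Set (List ι)), (∀ τ, IsOpenDescendant J F w ω ρ n τ → ∃ σ ∈ Γ, ρ <+: σ ∧ σ <+: τ) →
      ℓ ρ * (1 - Ψ) ≤ ∑' σ : Γ, ℓ σ := by
    intro n Γ hΓ
    have h := le_mul_extinction_add_tsum hw1 (ℓ := ℓ)
      (fun σ i hne => rpow_diam_append_of_truncWeight_ne_zero hs.le hε hne) n ρ Γ hΓ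
    rw [ENNReal.mul_sub (fun _ _ => hℓρt), mul_one, tsub_le_iff_left]
    refine h.trans ?_
    gcongr
    exact le_iSup (fun n => extinction J F w n ρ ω) n
  -- The bound l_ρ / 2 on the diameters leaves room for radii still below l_ρ, so open paths start
  -- at a cell larger than every covering radius.
  have hmain : ∀ t : ℕ → Set (EuclideanSpace ℝ (Fin d)), K ⊆ ⋃ n, t n →
      (∀ n, Metric.ediam (t n) ≤ ENNReal.ofReal (l ρ / 2)) →
      ℓ ρ * (1 - Ψ) ≤ M * ∑' n, ⨆ _ : (t n).Nonempty, Metric.ediam (t n) ^ s := by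
    intro t hKt ht
    set S := ∑' n, ⨆ _ : (t n).Nonempty, Metric.ediam (t n) ^ s
    suffices h : ∀ η : ℝ≥0, 0 < η → ℓ ρ * (1 - Ψ) ≤ M * (S + η) by
      have hlim : Tendsto (fun η : ℝ≥0 => M * (S + η)) (𝓝[>] 0) (𝓝 (M * (S + (0 : ℝ≥0)))) := by
        refine (ENNReal.Tendsto.const_mul ?_ (Or.inr hMt))
        refine Tendsto.const_add _ ?_
        exact (ENNReal.continuous_coe.tendsto 0).mono_left nhdsWithin_le_nhds
      have := ge_of_tendsto hlim (by filter_upwards [self_mem_nhdsWithin] with η hη using h η hη)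
      simpa using this
    intro η hη
    obtain ⟨δ, hδ0, hδ⟩ := ENNReal.exists_pos_sum_of_countable
      (ENNReal.coe_ne_zero.2 hη.ne') ℕ
    have hball : ∀ n, ∃ (z : EuclideanSpace ℝ (Fin d)) (r : ℝ), 0 < r ∧ r < l ρ ∧
        t n ⊆ Metric.ball z r ∧
        ENNReal.ofReal r ^ s ≤ (⨆ _ : (t n).Nonempty, Metric.ediam (t n) ^ s) + δ n := by
      intro n
      have hδn : ((δ n : ℝ≥0) : ℝ≥0∞) ≠ 0 := ENNReal.coe_ne_zero.2 (hδ0 n).ne'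
      rcases (t n).eq_empty_or_nonempty with he | hne
      · obtain ⟨r, h1, h2, h3⟩ := exists_gt_rpow_le_add hs.le hρ hδn
        refine ⟨0, r, h1, h2, by simp [he], ?_⟩
        simpa [he, hs] using h3
      · obtain ⟨z, hz⟩ := hne
        have hbdd : Metric.ediam (t n) ≠ ∞ := ((ht n).trans_lt ENNReal.ofReal_lt_top).ne
        have hdlt : Metric.diam (t n) < l ρ := by
          have := ENNReal.toReal_mono ENNReal.ofReal_ne_top (ht n)
          rw [ENNReal.toReal_ofReal (by positivity)] at this
          change Metric.diam (t n) ≤ _ at this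
          linarith
        obtain ⟨r, h1, h2, h3⟩ := exists_gt_rpow_le_add hs.le hdlt hδn
        refine ⟨z, r, Metric.diam_nonneg.trans_lt h1, h2, fun x hx => ?_, ?_⟩
        · exact (Metric.dist_le_diam_of_mem' hbdd hx hz).trans_lt h1
        · rw [Metric.diam, ENNReal.ofReal_toReal hbdd] at h3
          simpa [show (t n).Nonempty from ⟨z, hz⟩] using h3
    choose z r hr0 hrl htb hrs using hball
    have hKcpt : IsCompact K := (isCompact_openLevel 0).of_isClosed_subset
      (isClosed_iInter fun n => (isCompact_openLevel n).isClosed) (iInter_subset _ 0)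
    obtain ⟨I, hI⟩ := hKcpt.elim_finite_subcover (fun n => Metric.ball (z n) (r n))
      (fun _ => Metric.isOpen_ball) (hKt.trans (iUnion_mono htb))
    have hopen : IsOpen (⋃ n ∈ I, Metric.ball (z n) (r n)) :=
      isOpen_biUnion fun _ _ => Metric.isOpen_ball
    -- The compact levels decrease to K, so some level is already contained in the finite open
    -- cover.
    obtain ⟨N₁, hN₁⟩ := exists_subset_nhds_of_isCompact
      (directed_of_isDirected_le (antitone_openLevel hC) : Directed (· ⊇ ·) (openLevel J F w ω ρ))
      (fun n => isCompact_openLevel n) (fun x hx => hopen.mem_nhds (hI hx))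
    have hsmall : ∃ N₂, ∀ N, N₂ ≤ N → ∀ τ, IsOpenDescendant J F w ω ρ N τ →
        ∀ n ∈ I, l τ ≤ r n := by
      -- For ε > 1 the interval [ε, 1 - ε] is empty and there are no open steps; otherwise 0 ≤ 1 - ε
      -- < 1 and sizes decay geometrically.
      by_cases hε1 : 1 < ε
      · refine ⟨1, fun N hN τ hτ => ?_⟩
        cases hτ with
        | refl => omega
        | step _ _ hne =>
          have := mem_of_truncWeight_ne_zero hne
          linarith [this.1, this.2]
      · have hlim : Tendsto (fun n : ℕ => (1 - ε) ^ n * l ρ) atTop (𝓝 0) := by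
          simpa using (tendsto_pow_atTop_nhds_zero_of_lt_one (by linarith)
            (by linarith : 1 - ε < 1)).mul_const (l ρ)
        have hev : ∀ᶠ N in atTop, ∀ n ∈ I, (1 - ε) ^ N * l ρ < r n :=
          (Finset.eventually_all I).2 fun n _ => hlim.eventually (gt_mem_nhds (hr0 n))
        obtain ⟨N₂, hN₂⟩ := eventually_atTop.1 hev
        exact ⟨N₂, fun N hN τ hτ n hn => (hτ.diam_le hε).trans (hN₂ N hN n hn).le⟩
    obtain ⟨N₂, hN₂⟩ := hsmall
    set N := max N₁ N₂
    have hΓ : ∀ τ, IsOpenDescendant J F w ω ρ N τ →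
        ∃ σ ∈ ⋃ n ∈ I, stoppedCells J s ε ω (z n) (r n), ρ <+: σ ∧ σ <+: τ := by
      intro τ hτ
      obtain ⟨x, hx⟩ := nonempty_of_diam_pos (hτ.diam_pos hε hρ)
      have hxN : x ∈ openLevel J F w ω ρ N₁ := antitone_openLevel hC (le_max_left N₁ N₂)
        (mem_biUnion (show τ ∈ {τ | IsOpenDescendant J F w ω ρ N τ} from hτ) hx)
      obtain ⟨n, hn, hxn⟩ := mem_iUnion₂.1 (hN₁ hxN)
      -- The path is stopped at the scale of the particular ball containing a point x of its end
      -- cell; x also lies in the stopped cell, so that cell meets the ball.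
      obtain ⟨m, σ, i, h1, h2, h3, h4, h5, h6⟩ := hτ.exists_first (p := fun σ => l σ ≤ r n)
        (not_le.2 (hrl n)) (hN₂ N (le_max_right _ _) τ hτ n hn)
      refine ⟨σ ++ [i], mem_iUnion₂.2 ⟨n, hn, σ, i, rfl, h3, not_le.1 h4, h5, x, ?_, hxn⟩,
        h1.prefix.trans (List.prefix_append _ _), h6⟩
      exact hC.subset_of_prefix h6 hx
    calc ℓ ρ * (1 - Ψ) ≤ ∑' σ : ↥(⋃ n ∈ I, stoppedCells J s ε ω (z n) (r n)), ℓ σ := hcut N _ hΓ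
      _ ≤ ∑ n ∈ I, ∑' σ : stoppedCells J s ε ω (z n) (r n), ℓ σ := ENNReal.tsum_biUnion_le ℓ I _
      _ ≤ ∑ n ∈ I, M * ENNReal.ofReal (r n) ^ s := Finset.sum_le_sum fun n _ =>
          tsum_stoppedCells_le hC hρ₀ hb hbd hd hs.le hε (z n) (hr0 n)
      _ ≤ ∑' n, M * ENNReal.ofReal (r n) ^ s := ENNReal.sum_le_tsum _
      _ ≤ ∑' n, M * ((⨆ _ : (t n).Nonempty, Metric.ediam (t n) ^ s) + δ n) :=
          ENNReal.tsum_le_tsum fun n => mul_le_mul' le_rfl (hrs n)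
      _ = M * (S + ∑' n, (δ n : ℝ≥0∞)) := by rw [ENNReal.tsum_mul_left, ENNReal.tsum_add]
      _ ≤ M * (S + η) := by gcongr
  have hHaus : μH[s] K ≠ 0 := by
    intro h0
    rw [Measure.hausdorffMeasure_apply] at h0
    have h1 := le_iSup₂ (f := fun (r : ℝ≥0∞) (_ : 0 < r) =>
      ⨅ (t : ℕ → Set (EuclideanSpace ℝ (Fin d))) (_ : K ⊆ ⋃ n, t n)
        (_ : ∀ n, Metric.ediam (t n) ≤ r), ∑' n, ⨆ _ : (t n).Nonempty, Metric.ediam (t n) ^ s)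
      (ENNReal.ofReal (l ρ / 2)) (ENNReal.ofReal_pos.2 (half_pos hρ))
    rw [h0, nonpos_iff_eq_zero] at h1
    have hpos : 0 < ℓ ρ * (1 - Ψ) := ENNReal.mul_pos hℓρ0 (tsub_pos_of_lt hΨ1).ne'
    have hM0 : M ≠ 0 := by
      rw [hM]
      have : 0 < (2 / (ρ₀ / Metric.diam J₀ * ε)) ^ d := by positivity
      simpa using this
    have h2 : ℓ ρ * (1 - Ψ) / M ≤ 0 := by
      rw [← h1]
      refine le_iInf fun t => le_iInf fun h => le_iInf fun h' => ?_
      rw [ENNReal.div_le_iff hM0 hMt, mul_comm _ M]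
      exact hmain t h h'
    exact absurd h2 (not_le.2 (ENNReal.div_pos hpos.ne' hMt))
  have hsn : ENNReal.ofReal s ≤ dimH K :=
    le_dimH_of_hausdorffMeasure_ne_zero (d := s.toNNReal) (by rwa [Real.coe_toNNReal s hs.le])
  exact hsn.trans (dimH_mono (iInter_openLevel_subset_limitSet hC))

end HausdorffLowerBound

/-! ### The upper bound -/

section TotalMass

variable {ι : Type*}

/-- Summing over the last letter multiplies the total of each level by Σ m_i, so the levels form a
geometric series. -/
lemma tsum_list_eq_of_append {a : List ι → ℝ≥0∞} {m : ι → ℝ≥0∞}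
    (h : ∀ σ i, a (σ ++ [i]) = a σ * m i) :
    ∑' σ, a σ = a [] * ∑' k : ℕ, (∑' i, m i) ^ k := by
  have hlevel : ∀ k : ℕ, ∑' v : Fin k → ι, a (List.ofFn v) = a [] * (∑' i, m i) ^ k := by
    intro k
    induction k with
    | zero => simp
    | succ k ih =>
      rw [← (Fin.snocEquiv fun _ : Fin (k + 1) => ι).tsum_eq,
        ENNReal.tsum_prod (f := fun (i : ι) (v : Fin k → ι) =>
          a (List.ofFn ((Fin.snocEquiv fun _ : Fin (k + 1) => ι) (i, v)))), ENNReal.tsum_comm]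
      have : ∀ (v : Fin k → ι) (i : ι),
          a (List.ofFn ((Fin.snocEquiv fun _ : Fin (k + 1) => ι) (i, v))) =
            a (List.ofFn v) * m i := by
        intro v i
        rw [← h, List.ofFn_succ', List.concat_eq_append]
        simp [Fin.snocEquiv]
      simp_rw [this, ENNReal.tsum_mul_left, ENNReal.tsum_mul_right, ih, pow_succ, mul_assoc]
  rw [← List.equivSigmaTuple.symm.tsum_eq, ENNReal.tsum_sigma', ← ENNReal.tsum_mul_left]
  exact tsum_congr fun k => hlevel k

variable {Ω : Type*} [Countable ι] {d : ℕ} [MeasurableSpace Ω] {P : Measure Ω}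
  [IsProbabilityMeasure P] {J : List ι → Ω → Compacts (EuclideanSpace ℝ (Fin d))}

/-- The power of the relative diameter at σ is past-measurable and vanishes where σ is dead (as s >
0), so each appended letter factors out its root moment. -/
lemma lintegral_tsum_relDiam_rpow
    (hJm : ∀ σ, @Measurable Ω (Compacts (EuclideanSpace ℝ (Fin d))) _ (borel _) (J σ))
    (hI : CondIID P J)
    (hal : ∀ σ, ∀ᵐ ω ∂P, ω ∈ aliveSet J σ ↔ (J σ ω : Set (EuclideanSpace ℝ (Fin d))).Nonempty)
    {s : ℝ} (hs : 0 < s) :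
    ∫⁻ ω, ∑' σ, ENNReal.ofReal (relDiam J σ ω) ^ s ∂P =
      ∑' k : ℕ, (∑' i, ∫⁻ ω, ENNReal.ofReal (reductionVector J [] ω i) ^ s ∂P) ^ k := by
  have hm : ∀ σ, Measurable (relDiam J σ) := fun σ =>
    measurable_relDiam σ fun τ _ _ => measurable_reductionVector hJm τ
  rw [lintegral_tsum fun σ => ((hm σ).ennreal_ofReal.pow_const s).aemeasurable]
  rw [tsum_list_eq_of_append (a := fun σ => ∫⁻ ω, ENNReal.ofReal (relDiam J σ ω) ^ s ∂P)
    (m := fun i => ∫⁻ ω, ENNReal.ofReal (reductionVector J [] ω i) ^ s ∂P)]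
  · simp
  · intro σ i
    have hrestrict : ∀ X : Ω → ℝ≥0∞, ∫⁻ ω, ENNReal.ofReal (relDiam J σ ω) ^ s * X ω ∂P =
        ∫⁻ ω in aliveSet J σ, ENNReal.ofReal (relDiam J σ ω) ^ s * X ω ∂P := by
      intro X
      rw [← lintegral_indicator (pastSigmaAlgebra_le hJm {σ} _ (measurableSet_aliveSet_past σ))]
      congr 1
      ext ω
      by_cases h : ω ∈ aliveSet J σ
      · rw [indicator_of_mem h]
      · rw [indicator_of_notMem h, ENNReal.ofReal_of_nonpos (not_lt.1 h),
          ENNReal.zero_rpow_of_pos hs, zero_mul]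
    have hg : Measurable fun t : ι → ℝ => ENNReal.ofReal (t i) ^ s :=
      (measurable_pi_apply i).ennreal_ofReal.pow_const s
    have hb : Measurable[pastSigmaAlgebra J {σ}]
        fun ω => ENNReal.ofReal (relDiam J σ ω) ^ s :=
      (measurable_relDiam_past σ).ennreal_ofReal.pow_const s
    have h1 := setLIntegral_mul_comp_reductionVector hJm hI hal σ hb hg
    have h2 := hrestrict fun _ => 1
    simp only [mul_one] at h2
    rw [h2, ← h1, ← hrestrict]
    congr 1
    ext ω
    rw [relDiam_append, ENNReal.ofReal_mul (relDiam_nonneg σ ω),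
      ENNReal.mul_rpow_of_nonneg _ _ hs.le]

end TotalMass

/-! ### Covering the limit set by one-step orbits -/

section UpperBound

lemma List.exists_first_prefix {α : Type*} {p : List α → Prop} (h0 : ¬ p []) {σ : List α}
    (h : p σ) : ∃ τ i, ¬ p τ ∧ p (τ ++ [i]) ∧ τ ++ [i] <+: σ := by
  induction σ using List.reverseRecOn with
  | nil => exact absurd h h0
  | append_singleton τ i ih =>
    by_cases hτ : p τ
    · obtain ⟨τ', i', h1, h2, h3⟩ := ih hτ
      exact ⟨τ', i', h1, h2, h3.trans (List.prefix_append _ _)⟩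
    · exact ⟨τ, i, hτ, h, List.prefix_refl _⟩

variable {ι Ω : Type*} {d : ℕ} {J : List ι → Ω → Compacts (EuclideanSpace ℝ (Fin d))}
  {J₀ : Set (EuclideanSpace ℝ (Fin d))} {ω : Ω}
  {S : List ι → ι → Ω → EuclideanSpace ℝ (Fin d) → EuclideanSpace ℝ (Fin d)} {s A : ℝ}

/-- A point of the limit set is within r of the orbit point in its first cell of size at most r, and
that orbit point is within r of a centre of the orbit's cover. The orbit belongs to a parent larger
than r, so regularity applies and the counts sum to the total mass. -/
lemma externalCoveringNumber_limitSet_le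
    (hC : IsCellTree J₀ fun σ => (J σ ω : Set (EuclideanSpace ℝ (Fin d))))
    (hS : ∀ τ i, (J (τ ++ [i]) ω : Set (EuclideanSpace ℝ (Fin d))).Nonempty →
      S τ i ω '' (J τ ω : Set (EuclideanSpace ℝ (Fin d))) = J (τ ++ [i]) ω)
    (hs : 0 < s)
    (hsum : ∑' τ, ENNReal.ofReal
      (Metric.diam (J τ ω : Set (EuclideanSpace ℝ (Fin d)))) ^ s ≠ ∞)
    (hreg : ∀ τ, ∀ x ∈ (J τ ω : Set (EuclideanSpace ℝ (Fin d))), ∀ r : ℝ≥0, 0 < r →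
      (r : ℝ) ≤ 2 * Metric.diam (J τ ω : Set (EuclideanSpace ℝ (Fin d))) →
      (Metric.externalCoveringNumber r (oneStepOrbit J S τ ω x) : ℝ≥0∞) ≤ ENNReal.ofReal
        (A * (Metric.diam (J τ ω : Set (EuclideanSpace ℝ (Fin d))) / (r : ℝ)) ^ s))
    {r : ℝ≥0} (hr : 0 < r)
    (hrroot : (r : ℝ) < Metric.diam (J [] ω : Set (EuclideanSpace ℝ (Fin d)))) :
    (Metric.externalCoveringNumber (2 * r) (limitSet J ω) : ℝ≥0∞) ≤
      ENNReal.ofReal A * ENNReal.ofReal ((r : ℝ) ^ (-s)) *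
        ∑' τ, ENNReal.ofReal (Metric.diam (J τ ω : Set (EuclideanSpace ℝ (Fin d)))) ^ s := by
  set l := fun σ => Metric.diam (J σ ω : Set (EuclideanSpace ℝ (Fin d))) with hl
  have hr' : (0 : ℝ) < r := by exact_mod_cast hr
  have hex : ∀ τ, ∃ (x : EuclideanSpace ℝ (Fin d)) (D : Set (EuclideanSpace ℝ (Fin d))),
      ((r : ℝ) < l τ → x ∈ (J τ ω : Set (EuclideanSpace ℝ (Fin d))) ∧
        Metric.IsCover r (oneStepOrbit J S τ ω x) D) ∧
      (D.encard : ℝ≥0∞) ≤ ENNReal.ofReal A * ENNReal.ofReal ((r : ℝ) ^ (-s)) *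
        ENNReal.ofReal (l τ) ^ s := by
    intro τ
    by_cases hlt : (r : ℝ) < l τ
    · obtain ⟨x, hx⟩ := nonempty_of_diam_pos (hr'.trans hlt)
      obtain ⟨D, hD, hDc⟩ := exists_isCover_encard_eq r (oneStepOrbit J S τ ω x)
      refine ⟨x, D, fun _ => ⟨hx, hD⟩, ?_⟩
      rw [hDc]
      refine (hreg τ x hx r hr (by change (r : ℝ) ≤ 2 * l τ; linarith)).trans (le_of_eq ?_)
      have hl0 : 0 ≤ l τ := (hr'.trans hlt).le
      rw [ENNReal.ofReal_rpow_of_nonneg hl0 hs.le, mul_assoc,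
        ← ENNReal.ofReal_mul (by positivity), mul_comm A, ENNReal.ofReal_mul (by positivity),
        mul_comm]
      congr 2
      rw [Real.div_rpow hl0 hr'.le, Real.rpow_neg hr'.le]
      field_simp
    -- Cells of size at most r are never parents of a first small cell and contribute no centres.
    · exact ⟨0, ∅, fun h => absurd h hlt, by simp⟩
  choose x D hxD hDc using hex
  have hcover : Metric.IsCover (2 * r) (limitSet J ω) (⋃ τ, D τ) := by
    rw [Metric.isCover_iff_subset_iUnion_closedBall]
    intro y hy
    -- Convergence of the sum leaves only finitely many cells of size at least r, so every word
    -- longer than all of these is small.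
    have hfin : {τ | ENNReal.ofReal (r : ℝ) ^ s ≤ ENNReal.ofReal (l τ) ^ s}.Finite :=
      ENNReal.finite_const_le_of_tsum_ne_top hsum (by
        have : 0 < ENNReal.ofReal (r : ℝ) ^ s :=
          ENNReal.rpow_pos (ENNReal.ofReal_pos.2 hr') ENNReal.ofReal_ne_top
        exact this.ne')
    obtain ⟨B, hB⟩ := (hfin.image List.length).bddAbove
    obtain ⟨σ, hσ, hyσ⟩ := mem_iUnion₂.1 (mem_iInter₂.1 hy (B + 1) (by omega))
    have hσr : l σ ≤ r := by
      by_contra! hlt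
      have : σ.length ≤ B := hB ⟨σ, by
        change ENNReal.ofReal (r : ℝ) ^ s ≤ ENNReal.ofReal (l σ) ^ s
        gcongr, rfl⟩
      omega
    obtain ⟨τ, i, h1, h2, h3⟩ := List.exists_first_prefix (p := fun σ => l σ ≤ r)
      (not_le.2 hrroot) hσr
    obtain ⟨hxτ, hcov⟩ := hxD τ (not_le.1 h1)
    have hyi : y ∈ (J (τ ++ [i]) ω : Set (EuclideanSpace ℝ (Fin d))) :=
      hC.subset_of_prefix h3 hyσ
    have hSx : S τ i ω (x τ) ∈ (J (τ ++ [i]) ω : Set (EuclideanSpace ℝ (Fin d))) := by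
      rw [← hS τ i ⟨y, hyi⟩]
      exact mem_image_of_mem _ hxτ
    have horb : S τ i ω (x τ) ∈ oneStepOrbit J S τ ω (x τ) := ⟨i, ⟨y, hyi, hy⟩, rfl⟩
    obtain ⟨c, hc, hdc⟩ := mem_iUnion₂.1
      (Metric.isCover_iff_subset_iUnion_closedBall.1 hcov horb)
    refine mem_iUnion₂.2 ⟨c, mem_iUnion.2 ⟨τ, hc⟩, ?_⟩
    rw [Metric.mem_closedBall] at hdc ⊢
    have h4 : dist y (S τ i ω (x τ)) ≤ r :=
      (Metric.dist_le_diam_of_mem (J (τ ++ [i]) ω).isCompact.isBounded hyi hSx).trans h2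
    push_cast
    linarith [dist_triangle y (S τ i ω (x τ)) c]
  have h1 : (Metric.externalCoveringNumber (2 * r) (limitSet J ω) : ℝ≥0∞) ≤
      ((⋃ τ, D τ).encard : ℝ≥0∞) := by
    exact_mod_cast hcover.externalCoveringNumber_le_encard
  calc _ ≤ ((⋃ τ, D τ).encard : ℝ≥0∞) := h1
    _ = ∑' _ : ↥(⋃ τ, D τ), (1 : ℝ≥0∞) := by rw [ENNReal.tsum_set_one]
    _ ≤ ∑' τ, ∑' _ : D τ, (1 : ℝ≥0∞) := ENNReal.tsum_iUnion_le_tsum (fun _ => 1) D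
    _ = ∑' τ, ((D τ).encard : ℝ≥0∞) := by simp_rw [ENNReal.tsum_set_one]
    _ ≤ ∑' τ, ENNReal.ofReal A * ENNReal.ofReal ((r : ℝ) ^ (-s)) * ENNReal.ofReal (l τ) ^ s :=
        ENNReal.tsum_le_tsum hDc
    _ = _ := by rw [ENNReal.tsum_mul_left]

theorem upperMinkowskiDim_limitSet_le
    (hC : IsCellTree J₀ fun σ => (J σ ω : Set (EuclideanSpace ℝ (Fin d))))
    (hS : ∀ τ i, (J (τ ++ [i]) ω : Set (EuclideanSpace ℝ (Fin d))).Nonempty →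
      S τ i ω '' (J τ ω : Set (EuclideanSpace ℝ (Fin d))) = J (τ ++ [i]) ω)
    (hs : 0 < s) (hA : 0 < A)
    (hroot : 0 < Metric.diam (J [] ω : Set (EuclideanSpace ℝ (Fin d))))
    (hsum : ∑' τ, ENNReal.ofReal
      (Metric.diam (J τ ω : Set (EuclideanSpace ℝ (Fin d)))) ^ s ≠ ∞)
    (hreg : ∀ τ, ∀ x ∈ (J τ ω : Set (EuclideanSpace ℝ (Fin d))), ∀ r : ℝ≥0, 0 < r →
      (r : ℝ) ≤ 2 * Metric.diam (J τ ω : Set (EuclideanSpace ℝ (Fin d))) →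
      (Metric.externalCoveringNumber r (oneStepOrbit J S τ ω x) : ℝ≥0∞) ≤ ENNReal.ofReal
        (A * (Metric.diam (J τ ω : Set (EuclideanSpace ℝ (Fin d))) / (r : ℝ)) ^ s)) :
    upperMinkowskiDim (limitSet J ω) ≤ ENNReal.ofReal s := by
  set V := ∑' τ, ENNReal.ofReal (Metric.diam (J τ ω : Set (EuclideanSpace ℝ (Fin d)))) ^ s
  have hpos : 0 < V.toReal := by
    refine ENNReal.toReal_pos (fun h0 => ?_) hsum
    have := ENNReal.tsum_eq_zero.1 h0 []
    rw [ENNReal.rpow_eq_zero_iff] at this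
    rcases this with ⟨h, _⟩ | ⟨_, h⟩
    · exact absurd (ENNReal.ofReal_eq_zero.1 h) (not_le.2 hroot)
    · linarith
  -- The factor 2^s arises from applying the estimate at radius r / 2.
  refine upperMinkowskiDim_le_of_externalCoveringNumber_le (C := A * 2 ^ s * V.toReal)
    (by positivity) ?_
  have hnhds : ∀ᶠ r : ℝ≥0 in 𝓝[>] 0,
      (r : ℝ) < Metric.diam (J [] ω : Set (EuclideanSpace ℝ (Fin d))) :=
    ((NNReal.continuous_coe.tendsto 0).mono_left nhdsWithin_le_nhds).eventually
      (gt_mem_nhds (by simpa using hroot))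
  filter_upwards [self_mem_nhdsWithin, hnhds] with r hr hrlt
  have hr0 : (0 : ℝ≥0) < r := hr
  have hr' : (0 : ℝ) < r := by exact_mod_cast hr0
  have h := externalCoveringNumber_limitSet_le hC hS hs hsum hreg (r := r / 2) (by positivity)
    (by push_cast; linarith)
  rw [mul_div_cancel₀ r (two_ne_zero)] at h
  refine h.trans (le_of_eq ?_)
  change _ * _ * V = _
  rw [← ENNReal.ofReal_toReal hsum, ← ENNReal.ofReal_mul hA.le, ← ENNReal.ofReal_mul
    (by positivity)]
  congr 1
  rw [NNReal.coe_div, Real.div_rpow hr'.le (by norm_num), NNReal.coe_ofNat,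
    Real.rpow_neg (by norm_num : (0 : ℝ) ≤ 2)]
  field_simp
  rw [ENNReal.ofReal_toReal hsum]

end UpperBound

/-! ### Almost sure properties of random recursive constructions -/

section Almost

/-- Diameters give r ≤ 1. If r = 1, a point of A at distance at least δ from f(A) has iterates that
are pairwise δ-separated, contradicting compactness. -/
lemma lt_one_of_image_ssubset {X : Type*} [MetricSpace X] {f : X → X} {r : ℝ} {A : Set X}
    (hr : 0 < r) (hf : ∀ x y, dist (f x) (f y) = r * dist x y) (hA : IsCompact A)
    (hd : 0 < Metric.diam A) (hss : f '' A ⊂ A) : r < 1 := by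
  by_contra! h1
  have hdiam := Metric.diam_mono hss.subset hA.isBounded
  rw [diam_image_of_dist_eq hr hf hA.isBounded] at hdiam
  have hr1 : r = 1 := le_antisymm (by nlinarith) h1
  subst hr1
  have hiso : Isometry f := Isometry.of_dist_eq fun x y => by rw [hf, one_mul]
  obtain ⟨x, hxA, hx⟩ := exists_of_ssubset hss
  have hcl : IsClosed (f '' A) := (hA.image hiso.continuous).isClosed
  obtain ⟨δ, hδ, hball⟩ := Metric.isOpen_iff.1 hcl.isOpen_compl x hx
  have hmap : MapsTo f A A := fun y hy => hss.subset (mem_image_of_mem f hy)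
  have hmem : ∀ n, f^[n] x ∈ A := fun n => hmap.iterate n hxA
  have hsep : ∀ m k, δ ≤ dist (f^[m] x) (f^[m + (k + 1)] x) := by
    intro m k
    have hit : ∀ y z, dist (f^[m] y) (f^[m] z) = dist y z := fun y z => by
      induction m with
      | zero => rfl
      | succ m ih => rw [Function.iterate_succ_apply', Function.iterate_succ_apply', hiso.dist_eq, ih]
    rw [Function.iterate_add_apply, hit]
    by_contra! hlt
    refine hball (show f^[k + 1] x ∈ Metric.ball x δ by rwa [Metric.mem_ball, dist_comm]) ?_
    rw [Function.iterate_succ_apply']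
    exact mem_image_of_mem f (hmem k)
  obtain ⟨a, -, φ, hφ, hlim⟩ := hA.tendsto_subseq hmem
  obtain ⟨N, hN⟩ := Metric.cauchySeq_iff'.1 hlim.cauchySeq δ hδ
  have h2 := hN (N + 1) (by omega)
  have h3 : φ N < φ (N + 1) := hφ (Nat.lt_succ_self N)
  obtain ⟨k, hk⟩ := Nat.exists_eq_add_of_lt h3
  have h4 := hsep (φ N) k
  rw [← add_assoc, ← hk, dist_comm] at h4
  exact absurd h2 (not_lt.2 h4)

variable {ι Ω : Type*} {d : ℕ} {J₀ : Set (EuclideanSpace ℝ (Fin d))}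
  {J : List ι → Ω → Compacts (EuclideanSpace ℝ (Fin d))}

lemma diam_eq_mul_relDiam {ω : Ω}
    (hC : IsCellTree J₀ fun σ => (J σ ω : Set (EuclideanSpace ℝ (Fin d))))
    (hroot : (J [] ω : Set (EuclideanSpace ℝ (Fin d))) = J₀) (σ : List ι) :
    Metric.diam (J σ ω : Set (EuclideanSpace ℝ (Fin d))) =
      Metric.diam J₀ * relDiam J σ ω := by
  induction σ using List.reverseRecOn with
  | nil => simp [hroot]
  | append_singleton σ i ih =>
    rw [relDiam_append, ← mul_assoc, ← ih, reductionVector]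
    -- In the degenerate case the quotient is the default 0, consistent with the child, whose
    -- diameter is also 0.
    rcases eq_or_ne (Metric.diam (J σ ω : Set (EuclideanSpace ℝ (Fin d)))) 0 with h | h
    · have := hC.diam_le_of_prefix (List.prefix_append σ [i])
      rw [h] at this
      rw [h, zero_mul]
      exact le_antisymm this Metric.diam_nonneg
    · field_simp

lemma IsCellTree.diam_pos_iff {C : List ι → Set (EuclideanSpace ℝ (Fin d))}
    (hC : IsCellTree J₀ C) (hbd : Bornology.IsBounded J₀) (hd : 0 < Metric.diam J₀)
    (σ : List ι) : 0 < Metric.diam (C σ) ↔ (C σ).Nonempty := by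
  refine ⟨nonempty_of_diam_pos, fun h => ?_⟩
  obtain ⟨f, ⟨r, hr, hf⟩, hfJ⟩ := hC.similar σ h
  rw [← hfJ, diam_image_of_dist_eq hr hf hbd]
  positivity

variable [MeasurableSpace Ω] {P : Measure Ω}

lemma IsRandomRecursiveConstruction.ae_reductionVector_lt_one
    (hJ : IsRandomRecursiveConstruction P J₀ J) (hd : 0 < Metric.diam J₀) :
    ∀ᵐ ω ∂P, ∀ i, 0 ≤ reductionVector J [] ω i ∧ reductionVector J [] ω i < 1 := by
  filter_upwards [hJ.similar, hJ.root, hJ.offspring_ssubset] with ω hsim hroot hss i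
  refine ⟨reductionVector_nonneg _ _ _, ?_⟩
  rw [reductionVector, hroot]
  rcases (J ([] ++ [i]) ω : Set (EuclideanSpace ℝ (Fin d))).eq_empty_or_nonempty with h | h
  · rw [h]; simp
  · obtain ⟨f, ⟨r, hr, hf⟩, hfJ⟩ := hsim _ h
    have hsub := hss [] i (by rw [hroot]; exact hJ.seed_nonempty)
    rw [hroot, ← hfJ] at hsub
    rw [← hfJ, diam_image_of_dist_eq hr hf hJ.seed_compact.isBounded, mul_div_cancel_right₀ _ hd.ne']
    exact lt_one_of_image_ssubset hr hf hJ.seed_compact hd hsub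

/-- A one-point seed has no nonempty proper subset, so the first generation is already empty. -/
lemma IsRandomRecursiveConstruction.ae_limitSet_eq_empty
    (hJ : IsRandomRecursiveConstruction P J₀ J) (hd : Metric.diam J₀ = 0) :
    ∀ᵐ ω ∂P, limitSet J ω = ∅ := by
  have hsub : J₀.Subsingleton := fun x hx y hy => dist_le_zero.1
    (hd ▸ Metric.dist_le_diam_of_mem hJ.seed_compact.isBounded hx hy)
  filter_upwards [hJ.root, hJ.offspring_ssubset] with ω hroot hss
  refine eq_empty_of_forall_notMem fun y hy => ?_
  obtain ⟨σ, hσ, hyσ⟩ := mem_iUnion₂.1 (mem_iInter₂.1 hy 1 le_rfl)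
  obtain ⟨i, rfl⟩ := List.length_eq_one_iff.1 hσ
  have h := hss [] i (by rw [hroot]; exact hJ.seed_nonempty)
  rw [hroot] at h
  obtain ⟨z, hz, hz'⟩ := exists_of_ssubset h
  exact hz' (hsub hz (h.subset hyσ) ▸ hyσ)

variable [Countable ι]

lemma IsRandomRecursiveConstruction.ae_isCellTree (hJ : IsRandomRecursiveConstruction P J₀ J) :
    ∀ᵐ ω ∂P, IsCellTree J₀ fun σ => (J σ ω : Set (EuclideanSpace ℝ (Fin d))) := by
  have hosc : ∀ᵐ ω ∂P, ∀ σ τ : List ι, σ.length = τ.length → σ ≠ τ →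
      interior (J σ ω : Set (EuclideanSpace ℝ (Fin d))) ∩ interior (J τ ω) = ∅ := by
    simp_rw [ae_all_iff]
    exact hJ.open_set_condition
  filter_upwards [hJ.similar, hJ.offspring_ssubset, hJ.offspring_empty, hosc] with ω h1 h2 h3 h4
  refine ⟨fun σ => (J σ ω).isCompact, h1, fun σ i => ?_, h4⟩
  rcases (J σ ω : Set (EuclideanSpace ℝ (Fin d))).eq_empty_or_nonempty with h | h
  · rw [h3 σ i h]
    exact empty_subset _
  · exact (h2 σ i h).subset

lemma IsRandomRecursiveConstruction.ae_mem_aliveSet_iff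
    (hJ : IsRandomRecursiveConstruction P J₀ J) (hd : 0 < Metric.diam J₀) (σ : List ι) :
    ∀ᵐ ω ∂P, ω ∈ aliveSet J σ ↔ (J σ ω : Set (EuclideanSpace ℝ (Fin d))).Nonempty := by
  filter_upwards [hJ.ae_isCellTree, hJ.root] with ω hC hroot
  rw [← hC.diam_pos_iff hJ.seed_compact.isBounded hd, diam_eq_mul_relDiam hC hroot,
    mul_pos_iff_of_pos_left hd]
  rfl

lemma measurableSet_setOf_finite_support :
    MeasurableSet {t : ι → ℝ | {i | t i ≠ 0}.Finite} := by
  have : {t : ι → ℝ | {i | t i ≠ 0}.Finite} =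
      ⋃ F : Finset ι, ⋂ i : ι, ⋂ _ : i ∉ F, {t : ι → ℝ | t i = 0} := by
    ext t
    simp only [mem_iUnion, mem_iInter]
    constructor
    · intro h
      refine ⟨h.toFinset, fun i hi => ?_⟩
      by_contra hne
      exact hi (h.mem_toFinset.2 hne)
    · rintro ⟨F, hF⟩
      refine F.finite_toSet.subset fun i hi => ?_
      by_contra hne
      exact hi (hF i hne)
  rw [this]
  refine MeasurableSet.iUnion fun F => MeasurableSet.iInter fun i => MeasurableSet.iInter fun _ => ?_
  exact measurable_pi_apply i (measurableSet_singleton 0)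

/-- Finiteness is the event that the reduction vector has finite support. It has full probability at
the root, and conditional independence carries this to every nonempty cell. -/
lemma IsRandomRecursiveConstruction.ae_finite_offspring
    (hJ : IsRandomRecursiveConstruction P J₀ J) (hd : 0 < Metric.diam J₀)
    (hfin : ∀ᵐ ω ∂P, {i : ι | (J [i] ω : Set (EuclideanSpace ℝ (Fin d))).Nonempty}.Finite) :
    ∀ᵐ ω ∂P, ∀ τ : List ι, (J τ ω : Set (EuclideanSpace ℝ (Fin d))).Nonempty →
      {i : ι | (J (τ ++ [i]) ω : Set (EuclideanSpace ℝ (Fin d))).Nonempty}.Finite := by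
  rw [ae_all_iff]
  intro τ
  set B : Set (ι → ℝ) := {t | {i | t i ≠ 0}.Finite}ᶜ with hB
  have hroot0 : P (reductionVector J [] ⁻¹' B) = 0 := by
    have : ∀ᵐ ω ∂P, reductionVector J [] ω ∉ B := by
      filter_upwards [hfin] with ω hω
      rw [hB, notMem_compl_iff]
      refine hω.subset fun i hi => ?_
      by_contra hcon
      have hne := not_nonempty_iff_eq_empty.1 hcon
      exact hi (by simp [reductionVector, hne])
    exact measure_eq_zero_iff_ae_notMem.2 this
  have h := measure_inter_preimage_reductionVector hJ.condIID (hJ.ae_mem_aliveSet_iff hd) τ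
    MeasurableSet.univ measurableSet_setOf_finite_support.compl
  rw [hroot0, mul_zero] at h
  have hnot : ∀ᵐ ω ∂P, ω ∉ univ ∩ aliveSet J τ ∩ reductionVector J τ ⁻¹' B :=
    measure_eq_zero_iff_ae_notMem.1 h
  filter_upwards [hnot, hJ.ae_isCellTree, hJ.ae_mem_aliveSet_iff hd τ] with ω h1 hC hal hne
  have hfinT : {i | reductionVector J τ ω i ≠ 0}.Finite := by
    by_contra hcon
    exact h1 ⟨⟨mem_univ _, hal.2 hne⟩, hcon⟩
  refine hfinT.subset fun i hi => ?_
  have hpos := (hC.diam_pos_iff hJ.seed_compact.isBounded hd (τ ++ [i])).2 hi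
  have hpos' := (hC.diam_pos_iff hJ.seed_compact.isBounded hd τ).2 hne
  exact (div_pos hpos hpos').ne'

/-- The expected sum of the `s`-th powers of the reduction ratios. -/
noncomputable def momentSum (P : Measure Ω)
    (J : List ι → Ω → Compacts (EuclideanSpace ℝ (Fin d))) (s : ℝ) : ℝ≥0∞ :=
  ∑' i, ∫⁻ ω, ENNReal.ofReal (reductionVector J [] ω i) ^ s ∂P

/-- Ratios in [0, 1) make the moments decrease in the exponent. Were m(s') ≥ 1 ≥ m(s), the two sums
would agree almost surely, forcing every ratio to vanish and m(s') = 0. -/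
lemma IsRandomRecursiveConstruction.momentSum_lt_one
    (hJ : IsRandomRecursiveConstruction P J₀ J) (hd : 0 < Metric.diam J₀) {s s' : ℝ} (hs : 0 < s)
    (hss : s < s') (h : momentSum P J s ≤ 1) : momentSum P J s' < 1 := by
  have hT := measurable_reductionVector hJ.measurable_cell []
  have hTi : ∀ i (p : ℝ), Measurable fun ω => ENNReal.ofReal (reductionVector J [] ω i) ^ p :=
    fun i p => (((measurable_pi_apply i).comp hT).ennreal_ofReal).pow_const p
  have hm : ∀ p, momentSum P J p =
      ∫⁻ ω, ∑' i, ENNReal.ofReal (reductionVector J [] ω i) ^ p ∂P := fun p =>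
    (lintegral_tsum fun i => (hTi i p).aemeasurable).symm
  have hmeas : ∀ p : ℝ, Measurable fun ω => ∑' i, ENNReal.ofReal (reductionVector J [] ω i) ^ p :=
    fun p => Measurable.tsum fun i => hTi i p
  have hT1 := hJ.ae_reductionVector_lt_one hd
  by_contra! hge
  rw [hm] at h hge
  have hle : ∀ᵐ ω ∂P, ∀ i, ENNReal.ofReal (reductionVector J [] ω i) ^ s' ≤
      ENNReal.ofReal (reductionVector J [] ω i) ^ s := by
    filter_upwards [hT1] with ω hω i
    exact ENNReal.rpow_le_rpow_of_exponent_ge (ENNReal.ofReal_le_one.2 (hω i).2.le) hss.le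
  have heq := ae_eq_of_ae_le_of_lintegral_le
    (hle.mono fun ω hω => ENNReal.tsum_le_tsum hω)
    (ne_top_of_le_ne_top (h.trans_lt ENNReal.one_lt_top).ne
      (lintegral_mono_ae (hle.mono fun ω hω => ENNReal.tsum_le_tsum hω)))
    (hmeas s).aemeasurable (h.trans hge)
  have hfin : ∀ᵐ ω ∂P, ∑' i, ENNReal.ofReal (reductionVector J [] ω i) ^ s < ∞ :=
    ae_lt_top (hmeas s) (h.trans_lt ENNReal.one_lt_top).ne
  have hzero : ∫⁻ ω, ∑' i, ENNReal.ofReal (reductionVector J [] ω i) ^ s' ∂P = 0 := by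
    rw [lintegral_eq_zero_iff (hmeas s')]
    filter_upwards [heq, hfin, hle, hT1] with ω h1 h2 h3 h4
    refine ENNReal.tsum_eq_zero.2 fun i => ?_
    by_contra hne
    have hTne : 0 < reductionVector J [] ω i := by
      refine lt_of_le_of_ne (h4 i).1 fun h0 => hne ?_
      rw [← h0, ENNReal.ofReal_zero, ENNReal.zero_rpow_of_pos (hs.trans hss)]
    have hlt : ENNReal.ofReal (reductionVector J [] ω i) ^ s' <
        ENNReal.ofReal (reductionVector J [] ω i) ^ s :=
      ENNReal.rpow_lt_rpow_of_exponent_gt (ENNReal.ofReal_pos.2 hTne)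
        (ENNReal.ofReal_lt_one.2 (h4 i).2) hss
    have := ENNReal.tsum_lt_tsum (h1 ▸ h2.ne) h3 hlt
    exact absurd h1 this.ne
  rw [hzero] at hge
  exact absurd hge (by simp)

lemma IsRandomRecursiveConstruction.ae_le_dimH [IsProbabilityMeasure P]
    (hJ : IsRandomRecursiveConstruction P J₀ J) (hd : 0 < Metric.diam J₀) {s : ℝ} (hs : 0 < s)
    (h : 1 < momentSum P J s) :
    ∀ᵐ ω ∂P, (limitSet J ω).Nonempty → ENNReal.ofReal s ≤ dimH (limitSet J ω) := by
  have hT := measurable_reductionVector hJ.measurable_cell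
  obtain ⟨F, ε, hε, hF⟩ := exists_one_lt_lintegral_truncWeight (hT [])
    (hJ.ae_reductionVector_lt_one hd) hs h
  obtain ⟨c, hc1, hc⟩ := exists_lintegral_prod_le_of_one_lt
    (fun i ω => truncWeight_le_one hs.le hε.le i (reductionVector J [] ω))
    (fun i => (measurable_truncWeight s ε i).comp (hT [])) hF
  have hint : (interior J₀).Nonempty := by
    rw [← closure_nonempty_iff, ← hJ.seed_regular]
    exact hJ.seed_nonempty
  obtain ⟨x₀, hx₀⟩ := hint
  obtain ⟨ρ₀, hρ₀, hb⟩ := Metric.isOpen_iff.1 isOpen_interior x₀ hx₀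
  have hal := hJ.ae_mem_aliveSet_iff hd
  filter_upwards [ae_survive_imp_exists_extinction_ne_one hJ.measurable_cell hJ.condIID hal
      (measurable_truncWeight s ε)
      (fun i t hne => hε.trans_le (mem_of_truncWeight_ne_zero hne).1) hc1 hc,
    hJ.ae_isCellTree, hJ.root, ae_all_iff.2 hal] with ω hω hC hroot hal hne
  obtain ⟨y, hy⟩ := hne
  -- A point of the limit set lies in a cell of every positive length, so the tree survives; length
  -- 0 is the seed.
  obtain ⟨σ, hσ, hext⟩ := hω fun n => by
    cases n with
    | zero => exact ⟨[], rfl, (hal []).2 (by rw [hroot]; exact hJ.seed_nonempty)⟩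
    | succ n =>
      obtain ⟨σ, hσ, hyσ⟩ := mem_iUnion₂.1 (mem_iInter₂.1 hy (n + 1) (by omega))
      exact ⟨σ, hσ, (hal σ).2 ⟨y, hyσ⟩⟩
  exact le_dimH_limitSet_of_extinction_ne_one hC hρ₀ (hb.trans interior_subset)
    hJ.seed_compact.isBounded hd hs hε
    ((hC.diam_pos_iff hJ.seed_compact.isBounded hd σ).2 ((hal σ).1 hσ)) hext

/-- Here the finite offspring hypothesis enters: finite orbits have dimension 0 < s, so the
regularity assumption is available with t = s at every cell. -/
lemma IsRandomRecursiveConstruction.ae_upperMinkowskiDim_le [IsProbabilityMeasure P]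
    (hJ : IsRandomRecursiveConstruction P J₀ J) (hd : 0 < Metric.diam J₀)
    {S : List ι → ι → Ω → EuclideanSpace ℝ (Fin d) → EuclideanSpace ℝ (Fin d)}
    (hS : IsOffspringSimilarities P J S) (hreg : HasRegularOrbits P J S)
    (hfin : ∀ᵐ ω ∂P, {i : ι | (J [i] ω : Set (EuclideanSpace ℝ (Fin d))).Nonempty}.Finite)
    {s : ℝ} (hs : 0 < s) (h : momentSum P J s < 1) :
    ∀ᵐ ω ∂P, upperMinkowskiDim (limitSet J ω) ≤ ENNReal.ofReal s := by
  obtain ⟨A, hA, hAreg⟩ := hreg s hs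
  have hmass := lintegral_tsum_relDiam_rpow hJ.measurable_cell hJ.condIID
    (hJ.ae_mem_aliveSet_iff hd) hs
  have hmass_ne : ∫⁻ ω, ∑' σ, ENNReal.ofReal (relDiam J σ ω) ^ s ∂P ≠ ∞ := by
    rw [hmass, ENNReal.tsum_geometric]
    exact ENNReal.inv_ne_top.2 (tsub_pos_of_lt h).ne'
  have hsum : ∀ᵐ ω ∂P, ∑' σ, ENNReal.ofReal (relDiam J σ ω) ^ s < ∞ := by
    refine ae_lt_top (Measurable.tsum fun σ => ?_) hmass_ne
    exact (measurable_relDiam σ fun τ _ _ =>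
      measurable_reductionVector hJ.measurable_cell τ).ennreal_ofReal.pow_const s
  filter_upwards [hAreg, hsum, hJ.ae_isCellTree, hJ.root, hS,
    hJ.ae_finite_offspring hd hfin] with ω h1 h2 hC hroot h4 h5
  refine upperMinkowskiDim_limitSet_le hC (fun τ i hne => (h4 τ i hne).2) hs hA
    (by rw [hroot]; exact hd) ?_ fun τ x hx r hr hrl => h1 τ x hx ?_ r hr hrl
  · simp_rw [diam_eq_mul_relDiam hC hroot, ENNReal.ofReal_mul Metric.diam_nonneg,
      ENNReal.mul_rpow_of_nonneg _ _ hs.le, ENNReal.tsum_mul_left]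
    exact ENNReal.mul_ne_top (ENNReal.rpow_ne_top_of_nonneg hs.le ENNReal.ofReal_ne_top) h2.ne
  · have hsub : oneStepOrbit J S τ ω x ⊆ (fun i => S τ i ω x) ''
        {i | (J (τ ++ [i]) ω : Set (EuclideanSpace ℝ (Fin d))).Nonempty} := by
      rintro y ⟨i, hi, rfl⟩
      exact ⟨i, hi.mono inter_subset_left, rfl⟩
    rw [upperMinkowskiDim_finite (((h5 τ ⟨x, hx⟩).image _).subset hsub)]
    exact ENNReal.ofReal_pos.2 hs

end Almost

/-! ### Comparison of the two estimates -/

theorem mainTheorem4 {ι Ω : Type*} [Countable ι] [MeasurableSpace Ω] {d : ℕ}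
    (P : Measure Ω) [IsProbabilityMeasure P]
    (J₀ : Set (EuclideanSpace ℝ (Fin d)))
    (J : List ι → Ω → Compacts (EuclideanSpace ℝ (Fin d)))
    (hJ : IsRandomRecursiveConstruction P J₀ J)
    (S : List ι → ι → Ω → EuclideanSpace ℝ (Fin d) → EuclideanSpace ℝ (Fin d))
    (hS : IsOffspringSimilarities P J S)
    (hreg : HasRegularOrbits P J S)
    (hfin : ∀ᵐ ω ∂P, {i : ι | (J [i] ω : Set (EuclideanSpace ℝ (Fin d))).Nonempty}.Finite) :
    ∀ᵐ ω ∂P,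
      dimH (limitSet J ω) = packingDim (limitSet J ω) ∧
      packingDim (limitSet J ω) = lowerMinkowskiDim (limitSet J ω) ∧
      lowerMinkowskiDim (limitSet J ω) = upperMinkowskiDim (limitSet J ω) := by
  suffices h : ∀ᵐ ω ∂P, upperMinkowskiDim (limitSet J ω) ≤ dimH (limitSet J ω) from
    h.mono fun ω hω => dimensions_eq_of_upperMinkowskiDim_le_dimH hω
  rcases Metric.diam_nonneg (s := J₀).eq_or_lt with hd | hd
  · filter_upwards [hJ.ae_limitSet_eq_empty hd.symm] with ω hω
    rw [hω, upperMinkowskiDim_finite finite_empty]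
    exact zero_le
  -- Rational exponents keep the exceptional set a countable union of null sets.
  have hup : ∀ᵐ ω ∂P, ∀ p : ℚ, 0 < (p : ℝ) → momentSum P J p < 1 →
      upperMinkowskiDim (limitSet J ω) ≤ ENNReal.ofReal p := by
    refine ae_all_iff.2 fun p => ?_
    by_cases hp : 0 < (p : ℝ) ∧ momentSum P J p < 1
    · filter_upwards [hJ.ae_upperMinkowskiDim_le hd hS hreg hfin hp.1 hp.2] with ω hω _ _ using hω
    · exact Eventually.of_forall fun ω h1 h2 => absurd ⟨h1, h2⟩ hp
  have hlow : ∀ᵐ ω ∂P, ∀ p : ℚ, 0 < (p : ℝ) → 1 < momentSum P J p →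
      (limitSet J ω).Nonempty → ENNReal.ofReal p ≤ dimH (limitSet J ω) := by
    refine ae_all_iff.2 fun p => ?_
    by_cases hp : 0 < (p : ℝ) ∧ 1 < momentSum P J p
    · filter_upwards [hJ.ae_le_dimH hd hp.1 hp.2] with ω hω _ _ using hω
    · exact Eventually.of_forall fun ω h1 h2 => absurd ⟨h1, h2⟩ hp
  filter_upwards [hup, hlow] with ω h1 h2
  rcases (limitSet J ω).eq_empty_or_nonempty with he | hne
  · rw [he, upperMinkowskiDim_finite finite_empty]
    exact zero_le
  by_contra! hlt
  -- Two rationals p < p' in the supposed gap: m(p) > 1 contradicts the lower estimate at p, and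
  -- m(p) ≤ 1 contradicts the upper estimate at p'.
  obtain ⟨p', -, hp1', hp2'⟩ := ENNReal.lt_iff_exists_rat_btwn.1 hlt
  obtain ⟨p, -, hp1, hp2⟩ := ENNReal.lt_iff_exists_rat_btwn.1 hp1'
  change _ < ENNReal.ofReal p at hp1
  change ENNReal.ofReal p < ENNReal.ofReal p' at hp2
  change ENNReal.ofReal p' < _ at hp2'
  have hp0 : 0 < (p : ℝ) := ENNReal.ofReal_pos.1 (zero_le.trans_lt hp1)
  have hpp : (p : ℝ) < p' := ENNReal.ofReal_lt_ofReal_iff'.1 hp2 |>.1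
  rcases le_or_gt (momentSum P J p) 1 with hm | hm
  · exact absurd (h1 p' (hp0.trans hpp) (hJ.momentSum_lt_one hd hp0 hpp hm)) (not_le.2 hp2')
  · exact absurd (h2 p hp0 hm hne) (not_le.2 hp1)
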